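/- Let $\mathfrak H$ be a real separable Hilbert space and let $X=\{X(h):h\in\mathfrak H\}$ be an isonormal Gaussian process over $\mathfrak H$ on a probability space $(\Omega,\mathcal F,\mathbb P)$, i.e. a centred Gaussian family with $\mathbb E[X(h)X(k)]=\langle h,k\rangle$. Let $\mathfrak H^{\odot 2}$ be the symmetric Hilbert tensor square of $\mathfrak H$, and let $I_2:\mathfrak H^{\odot 2}\to L^2(\Omega)$ be the double Wiener–Itô integral, i.e. the continuous linear map with $I_2(h\otimes h)=X(h)^2-\|h\|^2$ for all $h\in\mathfrak H$. Let $D$ be the Malliavin derivative, i.e. the closure in $L^2(\Omega)\times L^2(\Omega;\mathfrak H)$ of the operator $g(X(h_1),\dots,X(h_n))\mapsto\sum_{i=1}^n\partial_i g(X(h_1),\dots,X(h_n))\,h_i$, where $n\in\mathbb N$, $h_1,\dots,h_n\in\mathfrak H$ and $g:\mathbb R^n\to\mathbb R$ is smooth with all derivatives of polynomial growth. Let $f\in\mathfrak H^{\odot 2}$ and let $Z=I_2(f)$ satisfy, almost surely, $\|DZ\|_{\mathfrak H}^2\le aZ+b$ for some constants $a\ge 0$ and $b>0$. Then for all $t>0$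 $$\mathbb P(Z\ge t)\le\varphi_r(t;a,b):=e^{-\frac{2t}{a}}\Big(1+\frac{at}{b}\Big)^{\frac{2b}{a^2}},\qquad \mathbb P(Z\le -t)\le\varphi_l(t;a,b):=e^{\frac{2t}{a}}\Big(1-\frac{at}{b}\Big)^{\frac{2b}{a^2}}\mathbf 1_{[0,b/a]}(t),$$ where for $a=0$ both right-hand sides are read as their limits as $a\downarrow 0$, namely $e^{-t^2/b}$. These bounds sharpen those of Nourdin and Viens: for all $t>0$, $$\varphi_r(t;a,b)\le\exp\Big(-\frac{t^2}{at+b}\Big),\qquad \varphi_l(t;a,b)\le\exp\Big(-\frac{t^2}{b}\Big),$$ and both inequalities are strict when $a>0$. -/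

import Mathlib

open MeasureTheory ProbabilityTheory
open scoped TensorProduct ENNReal

/-! ### Isonormal Gaussian processes -/

/-- `X = {X(h) : h ∈ H}` is an isonormal Gaussian process over the real Hilbert space `H`: a centred
Gaussian family of random variables with `E[X(h) X(k)] = ⟪h, k⟫`. -/
structure IsIsonormal {Ω H : Type*} [MeasurableSpace Ω] [NormedAddCommGroup H]
    [InnerProductSpace ℝ H] (X : H → Ω → ℝ) (P : Measure Ω) : Prop where
  isGaussianProcess : IsGaussianProcess X P
  integral_eq_zero : ∀ h, ∫ ω, X h ω ∂P = 0
  covariance_eq : ∀ h k, ∫ ω, X h ω * X k ω ∂P = inner ℝ h k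

/-- The fourth derivative at `0` of the moment generating function of a centred Gaussian. -/
theorem iteratedDeriv_four_gaussian_mgf (v : ℝ) :
    iteratedDeriv 4 (fun t : ℝ ↦ Real.exp (v * t ^ 2 / 2)) 0 = 3 * v ^ 2 := by
  have he : ∀ t : ℝ, HasDerivAt (fun t : ℝ ↦ Real.exp (v * t ^ 2 / 2))
      (Real.exp (v * t ^ 2 / 2) * (v * t)) t := by
    intro t
    have h1 : HasDerivAt (fun t : ℝ ↦ v * t ^ 2 / 2) (v * t) t :=
      (((hasDerivAt_pow 2 t).const_mul v).div_const 2).congr_deriv (by push_cast; ring)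
    exact h1.exp
  have step : ∀ (p q : ℝ → ℝ), (∀ t, HasDerivAt p (q t) t) →
      deriv (fun t : ℝ ↦ p t * Real.exp (v * t ^ 2 / 2)) =
        fun t ↦ (q t + p t * (v * t)) * Real.exp (v * t ^ 2 / 2) := by
    intro p q hp
    funext t
    refine (HasDerivAt.deriv (((hp t).fun_mul (he t)))).trans ?_
    ring
  have d1 : deriv (fun t : ℝ ↦ Real.exp (v * t ^ 2 / 2)) =
      fun t ↦ (v * t) * Real.exp (v * t ^ 2 / 2) := by
    funext t
    rw [(he t).deriv]
    ring
  have hm : ∀ (c : ℝ) (n : ℕ) (t : ℝ), HasDerivAt (fun t : ℝ ↦ c * t ^ n)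
      (c * (n * t ^ (n - 1))) t := fun c n t ↦ (hasDerivAt_pow n t).const_mul c
  rw [iteratedDeriv_succ, iteratedDeriv_succ, iteratedDeriv_succ, iteratedDeriv_one, d1]
  rw [step (fun t ↦ v * t) (fun _ ↦ v) (fun t ↦ by simpa using hm v 1 t)]
  rw [step (fun t ↦ v + v * t * (v * t)) (fun t ↦ 2 * v ^ 2 * t) (fun t ↦
    (((hm (v ^ 2) 2 t).const_add v).congr_deriv (by push_cast; ring)).congr_of_eventuallyEq
      (Filter.Eventually.of_forall fun s ↦ by ring))]
  rw [step (fun t ↦ 2 * v ^ 2 * t + (v + v * t * (v * t)) * (v * t))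
    (fun t ↦ 3 * v ^ 2 + 3 * v ^ 3 * t ^ 2) (fun t ↦
    (((hm (3 * v ^ 2) 1 t).fun_add (hm (v ^ 3) 3 t)).congr_deriv
      (by push_cast; ring)).congr_of_eventuallyEq
      (Filter.Eventually.of_forall fun s ↦ by ring))]
  simp

namespace IsIsonormal

variable {Ω H : Type*} [MeasurableSpace Ω] [NormedAddCommGroup H] [InnerProductSpace ℝ H]
  {X : H → Ω → ℝ} {P : Measure Ω}

theorem memLp (hX : IsIsonormal X P) (h : H) {p : ℝ≥0∞} (hp : p ≠ ∞) : MemLp (X h) p P :=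
  (hX.isGaussianProcess.hasGaussianLaw_eval h).memLp hp

theorem memLp_mul (hX : IsIsonormal X P) (h k : H) :
    MemLp (fun ω ↦ X h ω * X k ω) 2 P := by
  have : ENNReal.HolderTriple 4 4 2 := ⟨by
    rw [← two_mul, show (4 : ℝ≥0∞) = 2 * 2 by norm_num,
      ENNReal.mul_inv (by simp) (by simp), ← mul_assoc,
      ENNReal.mul_inv_cancel (by simp) (by simp), one_mul]⟩
  exact (hX.memLp k (p := 4) (by simp)).mul (hX.memLp h (p := 4) (by simp))

theorem integrable_mul (hX : IsIsonormal X P) (h k : H) :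
    Integrable (fun ω ↦ X h ω * X k ω) P :=
  (hX.memLp h (p := 2) (by simp)).integrable_mul (hX.memLp k (p := 2) (by simp))

theorem ae_eq_of_sq (f : Ω → ℝ) (hf : Integrable (fun ω ↦ f ω ^ 2) P)
    (h0 : ∫ ω, f ω ^ 2 ∂P = 0) : f =ᵐ[P] 0 := by
  have := (integral_eq_zero_iff_of_nonneg (fun ω ↦ sq_nonneg (f ω)) hf).1 h0
  filter_upwards [this] with ω hω
  simpa using hω

/-- `h ↦ X(h)` is almost surely additive. -/
theorem map_add_ae (hX : IsIsonormal X P) (h k : H) :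
    X (h + k) =ᵐ[P] fun ω ↦ X h ω + X k ω := by
  have e : (fun ω ↦ (X (h + k) ω - X h ω - X k ω) ^ 2) = fun ω ↦
      X (h + k) ω * X (h + k) ω + X h ω * X h ω + X k ω * X k ω
      + (-2) * (X (h + k) ω * X h ω) + (-2) * (X (h + k) ω * X k ω) + 2 * (X h ω * X k ω) := by
    funext ω
    ring
  have i1 := hX.integrable_mul (h + k) (h + k)
  have i2 := hX.integrable_mul h h
  have i3 := hX.integrable_mul k k
  have i4 := (hX.integrable_mul (h + k) h).const_mul (-2)
  have i5 := (hX.integrable_mul (h + k) k).const_mul (-2)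
  have i6 := (hX.integrable_mul h k).const_mul 2
  have := ae_eq_of_sq (fun ω ↦ X (h + k) ω - X h ω - X k ω)
    (by rw [e]; exact ((((i1.fun_add i2).fun_add i3).fun_add i4).fun_add i5).fun_add i6) (by
      rw [e, integral_add ((((i1.fun_add i2).fun_add i3).fun_add i4).fun_add i5) i6,
        integral_add (((i1.fun_add i2).fun_add i3).fun_add i4) i5, integral_add ((i1.fun_add i2).fun_add i3) i4,
        integral_add (i1.fun_add i2) i3, integral_add i1 i2]
      simp only [integral_const_mul, hX.covariance_eq, inner_add_left, inner_add_right]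
      rw [real_inner_comm h k]
      ring)
  filter_upwards [this] with ω hω
  simp only [Pi.zero_apply] at hω
  linarith

/-- `h ↦ X(h)` is almost surely homogeneous. -/
theorem map_smul_ae (hX : IsIsonormal X P) (c : ℝ) (h : H) :
    X (c • h) =ᵐ[P] fun ω ↦ c * X h ω := by
  have e : (fun ω ↦ (X (c • h) ω - c * X h ω) ^ 2) = fun ω ↦
      X (c • h) ω * X (c • h) ω + (-2 * c) * (X (c • h) ω * X h ω)
        + c ^ 2 * (X h ω * X h ω) := by
    funext ω
    ring
  have i1 := hX.integrable_mul (c • h) (c • h)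
  have i2 := (hX.integrable_mul (c • h) h).const_mul (-2 * c)
  have i3 := (hX.integrable_mul h h).const_mul (c ^ 2)
  have := ae_eq_of_sq (fun ω ↦ X (c • h) ω - c * X h ω)
    (by rw [e]; exact (i1.fun_add i2).fun_add i3) (by
      rw [e, integral_add (i1.fun_add i2) i3, integral_add i1 i2]
      simp only [integral_const_mul, hX.covariance_eq, inner_smul_left, inner_smul_right]
      simp only [conj_trivial]
      ring)
  filter_upwards [this] with ω hω
  simp only [Pi.zero_apply] at hω
  linarith

theorem integral_pow_four (hX : IsIsonormal X P) (h : H) :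
    ∫ ω, X h ω ^ 4 ∂P = 3 * (inner ℝ h h) ^ 2 := by
  have hP := hX.isGaussianProcess.isProbabilityMeasure
  have hg := hX.isGaussianProcess.hasGaussianLaw_eval h
  have hmap := hg.map_eq_gaussianReal
  have hvar : Var[X h; P] = inner ℝ h h := by
    rw [variance_eq_sub (hX.memLp h (by simp)), hX.integral_eq_zero, ← hX.covariance_eq]
    simp [pow_two]
  rw [hX.integral_eq_zero, hvar] at hmap
  have hmgf : mgf (X h) P = fun t ↦ Real.exp (inner ℝ h h * t ^ 2 / 2) := by
    funext t
    rw [mgf_gaussianReal hmap t]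
    simp
  have hint : (0 : ℝ) ∈ interior (integrableExpSet (X h) P) := by
    have : integrableExpSet (X h) P = Set.univ := by
      ext t
      simp only [integrableExpSet, Set.mem_ofPred_eq, Set.mem_univ, iff_true]
      rw [← mgf_pos_iff, hmgf]
      exact Real.exp_pos _
    rw [this]
    simp
  have := iteratedDeriv_mgf_zero hint 4
  rw [hmgf, iteratedDeriv_four_gaussian_mgf] at this
  rw [this]
  rfl

/-- The fourth joint moments of an isonormal process. -/
theorem integral_mul_mul (hX : IsIsonormal X P) (h k l m : H) :
    ∫ ω, (X h ω * X k ω) * (X l ω * X m ω) ∂P =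
      inner ℝ h k * inner ℝ l m + inner ℝ h l * inner ℝ k m + inner ℝ h m * inner ℝ k l := by
  have key : ∀ a b c : ℝ, (fun ω ↦ (X h ω + a * X k ω + b * X l ω + c * X m ω) ^ 4) =ᵐ[P]
      fun ω ↦ X (h + a • k + b • l + c • m) ω ^ 4 := by
    intro a b c
    filter_upwards [hX.map_add_ae (h + a • k + b • l) (c • m), hX.map_add_ae (h + a • k) (b • l),
      hX.map_add_ae h (a • k), hX.map_smul_ae a k, hX.map_smul_ae b l, hX.map_smul_ae c m]
      with ω h1 h2 h3 h4 h5 h6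
    rw [h1, h2, h3, h4, h5, h6]
  have int4 : ∀ g : H, Integrable (fun ω ↦ X g ω ^ 4) P := by
    intro g
    have := (hX.memLp g (p := ((4 : ℕ) : ℝ≥0∞)) (by simp)).integrable_norm_pow (by norm_num)
    refine this.congr (Filter.Eventually.of_forall fun ω ↦ ?_)
    simp only [Real.norm_eq_abs]
    exact Even.pow_abs (by decide) _
  have ki : ∀ a b c : ℝ,
      Integrable (fun ω ↦ (X h ω + a * X k ω + b * X l ω + c * X m ω) ^ 4) P :=
    fun a b c ↦ (int4 _).congr (key a b c).symm
  have kv : ∀ a b c : ℝ, ∫ ω, (X h ω + a * X k ω + b * X l ω + c * X m ω) ^ 4 ∂P =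
      3 * (inner ℝ h h + a ^ 2 * inner ℝ k k + b ^ 2 * inner ℝ l l + c ^ 2 * inner ℝ m m
        + 2 * a * inner ℝ h k + 2 * b * inner ℝ h l + 2 * c * inner ℝ h m
        + 2 * a * b * inner ℝ k l + 2 * a * c * inner ℝ k m + 2 * b * c * inner ℝ l m) ^ 2 := by
    intro a b c
    rw [integral_congr_ae (key a b c), hX.integral_pow_four]
    simp only [inner_add_left, inner_add_right, inner_smul_left, inner_smul_right, conj_trivial]
    rw [real_inner_comm h k, real_inner_comm h l, real_inner_comm h m, real_inner_comm k l,
      real_inner_comm k m, real_inner_comm l m]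
    ring
  have e : (fun ω ↦ (X h ω * X k ω) * (X l ω * X m ω)) = fun ω ↦ (1 / 192 : ℝ) * (
      ((X h ω + 1 * X k ω + 1 * X l ω + 1 * X m ω) ^ 4
        - (X h ω + 1 * X k ω + 1 * X l ω + (-1) * X m ω) ^ 4)
      + ((X h ω + 1 * X k ω + (-1) * X l ω + (-1) * X m ω) ^ 4
        - (X h ω + 1 * X k ω + (-1) * X l ω + 1 * X m ω) ^ 4)
      + ((X h ω + (-1) * X k ω + 1 * X l ω + (-1) * X m ω) ^ 4
        - (X h ω + (-1) * X k ω + 1 * X l ω + 1 * X m ω) ^ 4)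
      + ((X h ω + (-1) * X k ω + (-1) * X l ω + 1 * X m ω) ^ 4
        - (X h ω + (-1) * X k ω + (-1) * X l ω + (-1) * X m ω) ^ 4)) := by
    funext ω
    ring
  have j1 := (ki 1 1 1).sub' (ki 1 1 (-1))
  have j2 := (ki 1 (-1) (-1)).sub' (ki 1 (-1) 1)
  have j3 := (ki (-1) 1 (-1)).sub' (ki (-1) 1 1)
  have j4 := (ki (-1) (-1) 1).sub' (ki (-1) (-1) (-1))
  rw [e, integral_const_mul, integral_add ((j1.fun_add j2).fun_add j3) j4, integral_add (j1.fun_add j2) j3,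
    integral_add j1 j2, integral_sub (ki _ _ _) (ki _ _ _), integral_sub (ki _ _ _) (ki _ _ _),
    integral_sub (ki _ _ _) (ki _ _ _), integral_sub (ki _ _ _) (ki _ _ _)]
  simp only [kv]
  ring

/-! ### The double Wiener–Itô integral -/

theorem memLp_wick (hX : IsIsonormal X P) (h k : H) :
    MemLp (fun ω ↦ X h ω * X k ω - inner ℝ h k) 2 P := by
  have := hX.isGaussianProcess.isProbabilityMeasure
  exact (hX.memLp_mul h k).sub (memLp_const _)

/-- The Wick product `X(h) X(k) - ⟪h, k⟫` as an element of `L²(Ω)`. -/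
noncomputable def wickMul (hX : IsIsonormal X P) (h k : H) : Lp ℝ 2 P :=
  (hX.memLp_wick h k).toLp _

theorem coeFn_wickMul (hX : IsIsonormal X P) (h k : H) :
    hX.wickMul h k =ᵐ[P] fun ω ↦ X h ω * X k ω - inner ℝ h k :=
  (hX.memLp_wick h k).coeFn_toLp

/-- The linear map `H ⊗ H → L²(Ω)` on the algebraic tensor product that sends `h ⊗ k` to
`X(h) X(k) - ⟪h, k⟫`. -/
noncomputable def wickTensor (hX : IsIsonormal X P) : H ⊗[ℝ] H →ₗ[ℝ] Lp ℝ 2 P :=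
  TensorProduct.lift <| LinearMap.mk₂ ℝ hX.wickMul
    (fun h h' k ↦ by
      apply Lp.ext
      filter_upwards [hX.coeFn_wickMul (h + h') k, hX.coeFn_wickMul h k, hX.coeFn_wickMul h' k,
        Lp.coeFn_add (hX.wickMul h k) (hX.wickMul h' k), hX.map_add_ae h h'] with ω h1 h2 h3 h4 h5
      rw [h1, h4, Pi.add_apply, h2, h3, h5, inner_add_left]
      ring)
    (fun c h k ↦ by
      apply Lp.ext
      filter_upwards [hX.coeFn_wickMul (c • h) k, hX.coeFn_wickMul h k,
        Lp.coeFn_smul c (hX.wickMul h k), hX.map_smul_ae c h] with ω h1 h2 h4 h5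
      rw [h1, h4, Pi.smul_apply, h2, h5, real_inner_smul_left, smul_eq_mul]
      ring)
    (fun h k k' ↦ by
      apply Lp.ext
      filter_upwards [hX.coeFn_wickMul h (k + k'), hX.coeFn_wickMul h k, hX.coeFn_wickMul h k',
        Lp.coeFn_add (hX.wickMul h k) (hX.wickMul h k'), hX.map_add_ae k k'] with ω h1 h2 h3 h4 h5
      rw [h1, h4, Pi.add_apply, h2, h3, h5, inner_add_right]
      ring)
    (fun c h k ↦ by
      apply Lp.ext
      filter_upwards [hX.coeFn_wickMul h (c • k), hX.coeFn_wickMul h k,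
        Lp.coeFn_smul c (hX.wickMul h k), hX.map_smul_ae c k] with ω h1 h2 h4 h5
      rw [h1, h4, Pi.smul_apply, h2, h5, real_inner_smul_right, smul_eq_mul]
      ring)

theorem wickTensor_tmul (hX : IsIsonormal X P) (h k : H) :
    hX.wickTensor (h ⊗ₜ k) = hX.wickMul h k := rfl

theorem inner_wickTensor (hX : IsIsonormal X P) (x y : H ⊗[ℝ] H) :
    inner ℝ (hX.wickTensor x) (hX.wickTensor y) =
      inner ℝ x y + inner ℝ x (TensorProduct.comm ℝ H H y) := by
  have := hX.isGaussianProcess.isProbabilityMeasure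
  induction x using TensorProduct.induction_on with
  | zero => simp
  | add x x' hx hx' =>
    rw [map_add, inner_add_left, hx, hx', inner_add_left, inner_add_left]
    ring
  | tmul h k =>
    induction y using TensorProduct.induction_on with
    | zero => simp
    | add y y' hy hy' =>
      rw [map_add, inner_add_right, hy, hy', map_add, inner_add_right, inner_add_right]
      ring
    | tmul l m =>
      rw [wickTensor_tmul, wickTensor_tmul, L2.inner_def]
      have e : (fun ω ↦ inner ℝ (hX.wickMul h k ω) (hX.wickMul l m ω)) =ᵐ[P] fun ω ↦
          (X h ω * X k ω) * (X l ω * X m ω) + (-(inner ℝ l m)) * (X h ω * X k ω)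
          + (-(inner ℝ h k)) * (X l ω * X m ω) + inner ℝ h k * inner ℝ l m := by
        filter_upwards [hX.coeFn_wickMul h k, hX.coeFn_wickMul l m] with ω h1 h2
        rw [h1, h2]
        simp only [RCLike.inner_apply, conj_trivial]
        ring
      have i1 : Integrable (fun ω ↦ (X h ω * X k ω) * (X l ω * X m ω)) P :=
        (hX.memLp_mul h k).integrable_mul (hX.memLp_mul l m)
      have i2 := (hX.integrable_mul h k).const_mul (-(inner ℝ l m))
      have i3 := (hX.integrable_mul l m).const_mul (-(inner ℝ h k))
      rw [integral_congr_ae e, integral_add ((i1.fun_add i2).fun_add i3) (integrable_const _),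
        integral_add (i1.fun_add i2) i3, integral_add i1 i2, integral_const_mul, integral_const_mul,
        hX.covariance_eq, hX.covariance_eq, hX.integral_mul_mul]
      simp
      ring

theorem norm_wickTensor_le (hX : IsIsonormal X P) (x : H ⊗[ℝ] H) :
    ‖hX.wickTensor x‖ ≤ 2 * ‖x‖ := by
  have h1 := hX.inner_wickTensor x x
  rw [real_inner_self_eq_norm_sq, real_inner_self_eq_norm_sq x] at h1
  have h2 := real_inner_le_norm x (TensorProduct.comm ℝ H H x)
  rw [TensorProduct.norm_comm] at h2
  refine abs_le_of_sq_le_sq' ?_ (by positivity) |>.2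
  nlinarith [norm_nonneg x]

end IsIsonormal

/-- The Hilbert space tensor square `H ⊗ H` (completion of the algebraic tensor product). -/
abbrev HilbertTensorSquare (H : Type*) [NormedAddCommGroup H] [InnerProductSpace ℝ H] : Type _ :=
  UniformSpace.Completion (H ⊗[ℝ] H)

/-- The symmetric tensor square `H ⊙ H`: the closed linear span of the tensors `h ⊗ h`. -/
noncomputable def symmetricTensorSquare (H : Type*) [NormedAddCommGroup H]
    [InnerProductSpace ℝ H] : Submodule ℝ (HilbertTensorSquare H) :=
  (Submodule.span ℝ (Set.range fun h : H ↦
    ((h ⊗ₜ[ℝ] h : H ⊗[ℝ] H) : HilbertTensorSquare H))).topologicalClosure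

/-- The double Wiener–Itô integral `I₂ : H ⊙ H → L²(Ω)` with respect to the isonormal process `X`:
the continuous linear map with `I₂(h ⊗ h) = X(h)² - ‖h‖²`. -/
noncomputable def IsIsonormal.doubleIntegral {Ω H : Type*} [MeasurableSpace Ω]
    [NormedAddCommGroup H] [InnerProductSpace ℝ H] {X : H → Ω → ℝ} {P : Measure Ω}
    (hX : IsIsonormal X P) : symmetricTensorSquare H →L[ℝ] Lp ℝ 2 P :=
  ((hX.wickTensor.mkContinuous 2 hX.norm_wickTensor_le).extend
    (UniformSpace.Completion.toComplL : H ⊗[ℝ] H →L[ℝ] HilbertTensorSquare H)).comp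
    (symmetricTensorSquare H).subtypeL

/-- The defining property of `I₂`: the extension in its definition is the genuine one. -/
theorem IsIsonormal.coeFn_doubleIntegral {Ω H : Type*} [MeasurableSpace Ω]
    [NormedAddCommGroup H] [InnerProductSpace ℝ H] {X : H → Ω → ℝ} {P : Measure Ω}
    (hX : IsIsonormal X P) (f : symmetricTensorSquare H) (h : H)
    (hf : (f : HilbertTensorSquare H) = ((h ⊗ₜ[ℝ] h : H ⊗[ℝ] H) : HilbertTensorSquare H)) :
    hX.doubleIntegral f =ᵐ[P] fun ω ↦ X h ω ^ 2 - ‖h‖ ^ 2 := by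
  have e : hX.doubleIntegral f = hX.wickMul h h := by
    have := (hX.wickTensor.mkContinuous 2 hX.norm_wickTensor_le).extend_eq
      (e := (UniformSpace.Completion.toComplL : H ⊗[ℝ] H →L[ℝ] HilbertTensorSquare H))
      UniformSpace.Completion.denseRange_coe
      (UniformSpace.Completion.isUniformInducing_coe _) (h ⊗ₜ h)
    simp only [doubleIntegral, ContinuousLinearMap.comp_apply, Submodule.subtypeL_apply, hf]
    exact this
  rw [e]
  filter_upwards [hX.coeFn_wickMul h h] with ω hω
  rw [hω, real_inner_self_eq_norm_sq]
  ring

/-! ### The Malliavin derivative -/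

/-- The graph of the Malliavin derivative on smooth cylindrical random variables: the pairs
`(F, DF)` with `F = g(X(h₁), …, X(hₙ))` and `DF = ∑ᵢ ∂ᵢg(X(h₁), …, X(hₙ)) hᵢ`, where `g` is smooth
and all its derivatives have polynomial growth. -/
def cylindricalMalliavinGraph {Ω H : Type*} [MeasurableSpace Ω] [NormedAddCommGroup H]
    [InnerProductSpace ℝ H] (X : H → Ω → ℝ) (P : Measure Ω) : Set (Lp ℝ 2 P × Lp H 2 P) :=
  {F | ∃ (n : ℕ) (h : Fin n → H) (g : (Fin n → ℝ) → ℝ), Function.HasTemperateGrowth g ∧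
    (F.1 =ᵐ[P] fun ω ↦ g fun i ↦ X (h i) ω) ∧
    (F.2 =ᵐ[P] fun ω ↦ ∑ i, fderiv ℝ g (fun j ↦ X (h j) ω) (Pi.single i 1) • h i)}

/-- `DF` is the Malliavin derivative of `F`; the operator `D : L²(Ω) → L²(Ω; H)` is the closure of
its restriction to smooth cylindrical random variables. -/
def IsMalliavinDerivative {Ω H : Type*} [MeasurableSpace Ω] [NormedAddCommGroup H]
    [InnerProductSpace ℝ H] (X : H → Ω → ℝ) (P : Measure Ω) (F : Lp ℝ 2 P) (DF : Lp H 2 P) :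
    Prop :=
  (F, DF) ∈ closure (cylindricalMalliavinGraph X P)

/-! ### The tail bounds -/

/-- The right tail bound `e^{-2t/a} (1 + at/b)^{2b/a²}`, and its limit `e^{-t²/b}` for `a = 0`. -/
noncomputable def rightTailBound (a b t : ℝ) : ℝ :=
  if a = 0 then Real.exp (-(t ^ 2 / b))
  else Real.exp (-(2 * t / a)) * (1 + a * t / b) ^ (2 * b / a ^ 2)

/-- The left tail bound `e^{2t/a} (1 - at/b)^{2b/a²} 1_{[0, b/a]}(t)`, and its limit `e^{-t²/b}` for
`a = 0`. -/
noncomputable def leftTailBound (a b t : ℝ) : ℝ :=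
  if a = 0 then Real.exp (-(t ^ 2 / b))
  else (Set.Icc 0 (b / a)).indicator
    (fun s ↦ Real.exp (2 * s / a) * (1 - a * s / b) ^ (2 * b / a ^ 2)) t

/-! ### Gaussian integration by parts -/

/-! For $Z$ in the second chaos, Gaussian integration by parts gives
$E[Z\varphi(Z)]=\frac12E[\varphi'(Z)\|DZ\|^2]$. Taking $\varphi(z)=e^{sz}$ and inserting
$\|DZ\|^2\le aZ+b$ yields, for $M(s)=E[e^{sZ}]$, the inequality $M'\le\frac s2(aM'+bM)$, that is
$(\log M)'\le\frac{bs/2}{1-as/2}$. Integrating from $0$ and applying Chernoff's bound at the optimal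
$\theta=2t/(at+b)$ produces the right tail. The left tail is the same argument for $-Z$, with $a$
replaced by $-a$.

Two points need care. First, exponential moments of $Z$ are not assumed, so $Z$ is replaced by
$\chi_K(Z)$, with $\chi_K\le K$ increasing and concave, equal to the identity on $(-\infty,0]$. The
inequality `softTruncationDeriv_mul_le`, $\chi_K'(z)(az+b)\le a\chi_K(z)+b$, preserves the
differential inequality for both signs of $a$, and $K\to\infty$ is taken at the end
(`SatisfiesIBP.measureReal_le`).

Second, $DZ$ is given only as a point over $Z$ in the closure of a graph. `malliavin_unique` shows
that the closure is single-valued, so $DZ$ must be the $L^2$ limit of the derivatives $\sum_i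
2c_iX(k_i)k_i$ of quadratic approximations of $Z$. For these, integration by parts is
finite-dimensional (`integral_wickTensor_mul`), and both sides pass to the limit
(`integral_doubleIntegral_mul`).

The comparison with the Nourdin–Viens bounds reduces to $x<\sinh x$ for $x>0$ and
$\log(1-u)<-u-u^2/2$ for $0<u<1$. -/

theorem hasDerivAt_gaussianPDFReal (v : NNReal) (x : ℝ) :
    HasDerivAt (gaussianPDFReal 0 v) (-(x / v) * gaussianPDFReal 0 v x) x := by
  have h1 : HasDerivAt (fun x : ℝ ↦ -(x - 0) ^ 2 / (2 * v)) (-(x / v)) x := by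
    have := (((hasDerivAt_id x).sub_const 0).pow 2).neg.div_const (2 * (v : ℝ))
    refine this.congr_deriv ?_
    simp only [id]
    by_cases hv : (v : ℝ) = 0
    · simp [hv]
    · field_simp
      push_cast
      ring
  refine (h1.exp.const_mul ((Real.sqrt (2 * Real.pi * v))⁻¹)).congr_deriv ?_
  rw [gaussianPDFReal]
  ring

theorem integrable_gaussianReal_iff {v : NNReal} (hv : v ≠ 0) {f : ℝ → ℝ} :
    Integrable f (gaussianReal 0 v) ↔ Integrable fun x ↦ f x * gaussianPDFReal 0 v x := by
  rw [gaussianReal_of_var_ne_zero _ hv, integrable_withDensity_iff (measurable_gaussianPDF _ _)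
    (Filter.Eventually.of_forall fun _ ↦ gaussianPDF_lt_top)]
  simp [toReal_gaussianPDF]

/-- One-dimensional Gaussian integration by parts (Stein's lemma). -/
theorem integral_mul_id_gaussianReal {v : NNReal} (hv : v ≠ 0) {f f' : ℝ → ℝ}
    (hf : ∀ x, HasDerivAt f (f' x) x) (h0 : Integrable f (gaussianReal 0 v))
    (h1 : Integrable (fun x ↦ f x * x) (gaussianReal 0 v))
    (h2 : Integrable f' (gaussianReal 0 v)) :
    ∫ x, f x * x ∂(gaussianReal 0 v) = v * ∫ x, f' x ∂(gaussianReal 0 v) := by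
  have hv' : (v : ℝ) ≠ 0 := by simpa using hv
  rw [integrable_gaussianReal_iff hv] at h0 h1 h2
  rw [integral_gaussianReal_eq_integral_smul hv, integral_gaussianReal_eq_integral_smul hv]
  have := integral_mul_deriv_eq_deriv_mul_of_integrable (u := f) (u' := f')
    (v := gaussianPDFReal 0 v) (v' := fun x ↦ -(x / v) * gaussianPDFReal 0 v x)
    (fun x _ ↦ hf x) (fun x _ ↦ hasDerivAt_gaussianPDFReal v x)
    ((h1.const_mul (-(v : ℝ)⁻¹)).congr (Filter.Eventually.of_forall fun x ↦ by
      simp only [Pi.mul_apply]; ring)) h2 h0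
  have e1 : ∫ x, gaussianPDFReal 0 v x • (f x * x) =
      -(v * ∫ x, f x * (-(x / v) * gaussianPDFReal 0 v x)) := by
    rw [← integral_const_mul, ← integral_neg]
    congr 1
    funext x
    simp only [smul_eq_mul]
    field_simp
  rw [e1, this, mul_neg, neg_neg]
  congr 2
  funext x
  simp [mul_comm]

/-- A differentiable function which, together with its derivative, has polynomial growth. -/
def HasPolyGrowthDeriv {E : Type*} [NormedAddCommGroup E] [NormedSpace ℝ E] (g : E → ℝ) : Prop :=
  Differentiable ℝ g ∧ ∃ (C : ℝ) (N : ℕ), ∀ x,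
    ‖g x‖ ≤ C * (1 + ‖x‖) ^ N ∧ ‖fderiv ℝ g x‖ ≤ C * (1 + ‖x‖) ^ N

/-! ### Stability of polynomial growth -/

namespace HasPolyGrowthDeriv

variable {E F : Type*} [NormedAddCommGroup E] [NormedSpace ℝ E] [NormedAddCommGroup F]
  [NormedSpace ℝ F] {g k : E → ℝ}

theorem of_hasTemperateGrowth (hg : g.HasTemperateGrowth) : HasPolyGrowthDeriv g := by
  obtain ⟨N, C, -, h⟩ := hg.norm_iteratedFDeriv_le_uniform 1
  refine ⟨hg.1.differentiable (by simp), C, N, fun x ↦ ⟨?_, ?_⟩⟩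
  · simpa using h 0 (by simp) x
  · have := h 1 le_rfl x
    rwa [norm_iteratedFDeriv_one] at this

theorem of_hasTemperateGrowth_fderiv (hg : g.HasTemperateGrowth) (c : E) :
    HasPolyGrowthDeriv fun x ↦ fderiv ℝ g x c := by
  obtain ⟨N, C, hC, h⟩ := hg.norm_iteratedFDeriv_le_uniform 2
  have hd : Differentiable ℝ (fderiv ℝ g) :=
    (hg.1.fderiv_right (m := 1) (by norm_cast)).differentiable (by simp)
  refine ⟨hd.clm_apply (differentiable_const c), C * ‖c‖, N, fun x ↦ ⟨?_, ?_⟩⟩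
  · have := h 1 (by simp) x
    rw [norm_iteratedFDeriv_one] at this
    refine (ContinuousLinearMap.le_opNorm _ _).trans ?_
    rw [mul_right_comm]
    gcongr
  · have := h 2 le_rfl x
    have h2 : ‖fderiv ℝ (fderiv ℝ g) x‖ ≤ C * (1 + ‖x‖) ^ N := by
      rwa [← norm_iteratedFDeriv_one, norm_iteratedFDeriv_fderiv]
    have e : fderiv ℝ (fun x ↦ fderiv ℝ g x c) x = (fderiv ℝ (fderiv ℝ g) x).flip c := by
      rw [fderiv_clm_apply (hd x) (differentiableAt_const c)]
      simp
    rw [e]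
    refine (ContinuousLinearMap.le_opNorm _ _).trans ?_
    rw [ContinuousLinearMap.opNorm_flip, mul_right_comm]
    gcongr

theorem mul (hg : HasPolyGrowthDeriv g) (hk : HasPolyGrowthDeriv k) :
    HasPolyGrowthDeriv fun x ↦ g x * k x := by
  obtain ⟨hg, C, N, h⟩ := hg
  obtain ⟨hk, C', N', h'⟩ := hk
  -- The factor 2 pays for the two terms of the product rule.
  refine ⟨hg.mul hk, 2 * (C * C'), N + N', fun x ↦ ?_⟩
  obtain ⟨h1, h2⟩ := h x
  obtain ⟨h3, h4⟩ := h' x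
  have m : ∀ {p q : ℝ}, 0 ≤ p → 0 ≤ q → p ≤ C * (1 + ‖x‖) ^ N → q ≤ C' * (1 + ‖x‖) ^ N' →
      p * q ≤ (C * C') * (1 + ‖x‖) ^ (N + N') := fun hp hq h h' ↦
    (mul_le_mul h h' hq (hp.trans h)).trans (le_of_eq (by ring))
  constructor
  · rw [norm_mul]
    have := m (norm_nonneg _) (norm_nonneg _) h1 h3
    have h0 := mul_nonneg (norm_nonneg (g x)) (norm_nonneg (k x))
    linarith
  · rw [fderiv_fun_mul (hg x) (hk x)]
    refine (norm_add_le _ _).trans ?_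
    rw [norm_smul, norm_smul]
    have := m (norm_nonneg _) (norm_nonneg _) h1 h4
    have := m (norm_nonneg _) (norm_nonneg _) h2 h3
    linarith

theorem comp_clm (hg : HasPolyGrowthDeriv g) (L : F →L[ℝ] E) :
    HasPolyGrowthDeriv fun x ↦ g (L x) := by
  obtain ⟨hg, C, N, h⟩ := hg
  have hC : 0 ≤ C := by simpa using (norm_nonneg _).trans (h 0).1
  -- Of the powers of $1+\|L\|$, $N$ come from the growth bound at $Lx$ and one from the chain rule.
  refine ⟨hg.comp L.differentiable, C * (1 + ‖L‖) ^ (N + 1), N, fun x ↦ ?_⟩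
  obtain ⟨h1, h2⟩ := h (L x)
  have hL : 1 + ‖L x‖ ≤ (1 + ‖L‖) * (1 + ‖x‖) := by
    have := L.le_opNorm x
    nlinarith [norm_nonneg L, norm_nonneg x]
  have hb : C * (1 + ‖L x‖) ^ N ≤ C * ((1 + ‖L‖) ^ N * (1 + ‖x‖) ^ N) := by
    rw [← mul_pow]
    gcongr
  have h1L : (1 + ‖L‖) ^ N ≤ (1 + ‖L‖) ^ (N + 1) :=
    pow_le_pow_right₀ (by linarith [norm_nonneg L]) (by simp)
  constructor
  · refine (h1.trans hb).trans ?_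
    rw [mul_assoc]
    gcongr
  · have e : fderiv ℝ (fun x ↦ g (L x)) x = (fderiv ℝ g (L x)).comp L :=
      ((hg (L x)).hasFDerivAt.comp x L.hasFDerivAt).fderiv
    rw [e]
    calc _ ≤ ‖fderiv ℝ g (L x)‖ * ‖L‖ := ContinuousLinearMap.opNorm_comp_le _ _
      _ ≤ (C * ((1 + ‖L‖) ^ N * (1 + ‖x‖) ^ N)) * (1 + ‖L‖) := by
        gcongr
        · exact h2.trans hb
        · linarith
      _ = _ := by ring

end HasPolyGrowthDeriv

/-! ### Moments and integration by parts in finitely many Gaussian coordinates -/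

namespace IsIsonormal

variable {Ω H : Type*} [MeasurableSpace Ω] [NormedAddCommGroup H] [InnerProductSpace ℝ H]
  {X : H → Ω → ℝ} {P : Measure Ω}

theorem aemeasurable_pi (hX : IsIsonormal X P) {ι : Type*} [Fintype ι] (k : ι → H) :
    AEMeasurable (fun ω i ↦ X (k i) ω) P :=
  aemeasurable_pi_lambda _ fun i ↦ hX.isGaussianProcess.aemeasurable (k i)

/-- The sup norm is at most $\sum_i|X(k_i)|$, and Gaussian variables have moments of every finite
order; the $N$-th power lies in $L^p$ because the base lies in $L^{pN}$. -/
theorem memLp_poly (hX : IsIsonormal X P) {ι : Type*} [Fintype ι] (k : ι → H) (N : ℕ)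
    {p : ℝ≥0∞} (hp : p ≠ ∞) : MemLp (fun ω ↦ (1 + ‖fun i ↦ X (k i) ω‖) ^ N) p P := by
  have := hX.isGaussianProcess.isProbabilityMeasure
  have h1 : ∀ {q : ℝ≥0∞}, q ≠ ∞ → MemLp (fun ω ↦ 1 + ‖fun i ↦ X (k i) ω‖) q P := by
    intro q hq
    have hs' : MemLp (fun ω ↦ ∑ i, ‖X (k i) ω‖) q P :=
      memLp_finsetSum _ fun i _ ↦ (hX.memLp (k i) hq).norm
    have hs : MemLp (fun ω ↦ 1 + ∑ i, ‖X (k i) ω‖) q P :=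
      (memLp_const (μ := P) (p := q) (1 : ℝ)).add hs'
    refine hs.of_le ((hX.aemeasurable_pi k).norm.const_add 1).aestronglyMeasurable
      (Filter.Eventually.of_forall fun ω ↦ ?_)
    rw [Real.norm_of_nonneg (by positivity), Real.norm_of_nonneg (by positivity)]
    gcongr
    refine (pi_norm_le_iff_of_nonneg (by positivity)).2 fun i ↦ ?_
    exact Finset.single_le_sum (f := fun i ↦ ‖X (k i) ω‖) (fun _ _ ↦ norm_nonneg _)
      (Finset.mem_univ i)
  rcases Nat.eq_zero_or_pos N with rfl | hN
  · simpa using memLp_const (1 : ℝ)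
  have h2 := (h1 (q := p * N) (ENNReal.mul_ne_top hp (by simp))).norm_rpow_div (N : ℝ≥0∞)
  rw [ENNReal.mul_div_cancel_right (by simpa using hN.ne') (by simp)] at h2
  refine h2.congr_norm ((((hX.aemeasurable_pi k).norm.const_add 1).pow_const
    N).aestronglyMeasurable) (Filter.Eventually.of_forall fun ω ↦ ?_)
  simp

theorem memLp_of_polyGrowth (hX : IsIsonormal X P) {ι : Type*} [Fintype ι] (k : ι → H)
    {g : (ι → ℝ) → ℝ} (hm : Measurable g) {C : ℝ} {N : ℕ} (hg : ∀ x, ‖g x‖ ≤ C * (1 + ‖x‖) ^ N)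
    {p : ℝ≥0∞} (hp : p ≠ ∞) : MemLp (fun ω ↦ g fun i ↦ X (k i) ω) p P :=
  ((hX.memLp_poly k N hp).const_mul C).of_le
    (hm.comp_aemeasurable (hX.aemeasurable_pi k)).aestronglyMeasurable
    (Filter.Eventually.of_forall fun _ ↦ (hg _).trans (le_abs_self _))

theorem _root_.HasPolyGrowthDeriv.memLp (hX : IsIsonormal X P) {ι : Type*} [Fintype ι]
    (k : ι → H) {g : (ι → ℝ) → ℝ} (hg : HasPolyGrowthDeriv g) {p : ℝ≥0∞} (hp : p ≠ ∞) :
    MemLp (fun ω ↦ g fun i ↦ X (k i) ω) p P := by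
  obtain ⟨hd, C, N, h⟩ := hg
  exact hX.memLp_of_polyGrowth k hd.continuous.measurable (fun x ↦ (h x).1) hp

theorem _root_.HasPolyGrowthDeriv.memLp_fderiv (hX : IsIsonormal X P) {ι : Type*} [Fintype ι]
    (k : ι → H) {g : (ι → ℝ) → ℝ} (hg : HasPolyGrowthDeriv g) (c : ι → ℝ) {p : ℝ≥0∞}
    (hp : p ≠ ∞) : MemLp (fun ω ↦ fderiv ℝ g (fun i ↦ X (k i) ω) c) p P := by
  obtain ⟨hd, C, N, h⟩ := hg
  refine hX.memLp_of_polyGrowth k (g := fun x ↦ fderiv ℝ g x c) (measurable_fderiv_apply_const ℝ g c)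
    (C := C * ‖c‖) (N := N) (fun x ↦ ?_) hp
  refine (ContinuousLinearMap.le_opNorm _ _).trans ?_
  rw [mul_right_comm]
  gcongr
  exact (h x).2

/-- Gaussian integration by parts for functions of finitely many coordinates. -/
theorem integral_mul_eq (hX : IsIsonormal X P) {ι : Type*} [Fintype ι] (k : ι → H)
    {g : (ι → ℝ) → ℝ} (hg : HasPolyGrowthDeriv g) (h : H) :
    ∫ ω, g (fun i ↦ X (k i) ω) * X h ω ∂P =
      ∫ ω, fderiv ℝ g (fun i ↦ X (k i) ω) (fun i ↦ inner ℝ (k i) h) ∂P := by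
  have hP := hX.isGaussianProcess.isProbabilityMeasure
  -- For $h=0$ the law of $X(h)$ has no density, so the one-dimensional lemma does not apply; both
  -- sides vanish.
  rcases eq_or_ne h 0 with rfl | hh
  · have h0 : X 0 =ᵐ[P] 0 := by
      filter_upwards [hX.map_smul_ae 0 0] with ω hω
      simpa using hω
    have e0 : (fun ω ↦ g (fun i ↦ X (k i) ω) * X 0 ω) =ᵐ[P] 0 := by
      filter_upwards [h0] with ω hω
      simp [hω]
    have : (fun _ ↦ 0 : ι → ℝ) = 0 := rfl
    simp [integral_congr_ae e0, this]
  set v : NNReal := ⟨‖h‖ ^ 2, sq_nonneg _⟩ with hvdef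
  have hvh : (v : ℝ) = ‖h‖ ^ 2 := rfl
  have hv : v ≠ 0 := by
    rw [← NNReal.coe_ne_zero, hvh]
    simpa using hh
  have hv' : (v : ℝ) ≠ 0 := by simpa using hv
  set c : ι → ℝ := fun i ↦ inner ℝ (k i) h / v with hc
  set k' : ι → H := fun i ↦ k i - c i • h with hk'
  set R : Ω → ι → ℝ := fun ω i ↦ X (k' i) ω with hR
  have hRm : AEMeasurable R P := hX.aemeasurable_pi k'
  have hNm : AEMeasurable (X h) P := hX.isGaussianProcess.aemeasurable h
  have hXk : ∀ᵐ ω ∂P, (fun i ↦ X (k i) ω) = R ω + X h ω • c := by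
    have : ∀ᵐ ω ∂P, ∀ i, X (k i) ω = X (k' i) ω + X h ω * c i := by
      rw [ae_all_iff]
      intro i
      filter_upwards [hX.map_add_ae (k' i) (c i • h), hX.map_smul_ae (c i) h] with ω h1 h2
      rw [h2] at h1
      rw [mul_comm, ← h1]
      simp [hk']
    filter_upwards [this] with ω hω
    funext i
    simp [hω i, hR]
  have hind : IndepFun R (X h) P := by
    have h1 : IndepFun (fun ω i ↦ X (k' i) ω) (fun ω (_ : Unit) ↦ X h ω) P := by
      refine IsGaussianProcess.indepFun_of_covariance_eq_zero (X := fun i ↦ X (k' i))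
        (Y := fun _ : Unit ↦ X h) ?_ (fun i ↦ hX.isGaussianProcess.aemeasurable _)
        (fun _ ↦ hNm) ?_
      · have := hX.isGaussianProcess.comp_right (Sum.elim k' (fun _ : Unit ↦ h))
        rwa [Sum.comp_elim] at this
      · intro i _
        rw [covariance_eq_sub (hX.memLp _ (by simp)) (hX.memLp _ (by simp))]
        simp only [Pi.mul_apply, hX.covariance_eq, hX.integral_eq_zero]
        simp only [hk', hc, inner_sub_left, real_inner_smul_left, real_inner_self_eq_norm_sq]
        rw [← hvh]
        field_simp
        simp
    exact h1.comp (φ := id) (ψ := fun f : Unit → ℝ ↦ f ()) measurable_id (measurable_pi_apply ())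
  have hmap : P.map (fun ω ↦ (R ω, X h ω)) = (P.map R).prod (gaussianReal 0 v) := by
    rw [(indepFun_iff_map_prod_eq_prod_map_map hRm hNm).1 hind]
    congr 1
    have hgl := (hX.isGaussianProcess.hasGaussianLaw_eval h).map_eq_gaussianReal
    have hvar : Var[X h; P] = inner ℝ h h := by
      rw [variance_eq_sub (hX.memLp h (by simp)), hX.integral_eq_zero, ← hX.covariance_eq]
      simp [pow_two]
    rw [hX.integral_eq_zero, hvar, real_inner_self_eq_norm_sq] at hgl
    rw [hgl, ← hvh, Real.toNNReal_coe]
  have hpm : AEMeasurable (fun ω ↦ (R ω, X h ω)) P := hRm.prodMk hNm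
  have hPR : IsProbabilityMeasure (P.map R) := Measure.isProbabilityMeasure_map hRm
  have hcomb : Measurable fun p : (ι → ℝ) × ℝ ↦ p.1 + p.2 • c := by fun_prop
  -- transfer of integrals and integrability to the product space
  have tr : ∀ G : (ι → ℝ) × ℝ → ℝ, Measurable G → ∀ G' : Ω → ℝ, Integrable G' P →
      (∀ᵐ ω ∂P, G' ω = G (R ω, X h ω)) →
      Integrable G ((P.map R).prod (gaussianReal 0 v)) ∧
        ∫ ω, G' ω ∂P = ∫ r, ∫ x, G (r, x) ∂(gaussianReal 0 v) ∂(P.map R) := by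
    intro G hG G' hG' he
    have hi : Integrable G ((P.map R).prod (gaussianReal 0 v)) := by
      rw [← hmap, integrable_map_measure hG.aestronglyMeasurable hpm]
      exact hG'.congr he
    refine ⟨hi, ?_⟩
    rw [← integral_prod _ hi, ← hmap, integral_map hpm hG.aestronglyMeasurable]
    exact integral_congr_ae he
  have hgm := hg.1.continuous.measurable
  obtain ⟨i0, -⟩ := tr (fun p ↦ g (p.1 + p.2 • c)) (hgm.comp hcomb) _
    (memLp_one_iff_integrable.1 (hg.memLp hX k (by simp))) (hXk.mono fun ω hω ↦ by rw [hω])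
  obtain ⟨i1, e1⟩ := tr (fun p ↦ g (p.1 + p.2 • c) * p.2) ((hgm.comp hcomb).mul measurable_snd) _
    ((hg.memLp hX k (p := 2) (by simp)).integrable_mul (hX.memLp h (p := 2) (by simp)))
    (hXk.mono fun ω hω ↦ by simp only [Pi.mul_apply]; rw [hω])
  obtain ⟨i2, e2⟩ := tr (fun p ↦ fderiv ℝ g (p.1 + p.2 • c) c)
    ((measurable_fderiv_apply_const ℝ g c).comp hcomb) _
    (memLp_one_iff_integrable.1 (hg.memLp_fderiv hX k c (by simp)))
    (hXk.mono fun ω hω ↦ by rw [hω])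
  -- The direction of differentiation is $v\,c$; this scalar is the variance appearing in Stein's
  -- lemma.
  have hvc : (fun i ↦ inner ℝ (k i) h) = (v : ℝ) • c := by
    funext i
    simp only [hc, Pi.smul_apply, smul_eq_mul]
    field_simp
  simp only [hvc, map_smul, smul_eq_mul]
  rw [integral_const_mul, e2, ← integral_const_mul]
  refine e1.trans (integral_congr_ae ?_)
  -- By Fubini, it remains to apply Stein's lemma to $x\mapsto g(r+xc)$ for almost every frozen
  -- value $r$ of the residual.
  filter_upwards [i0.prod_right_ae, i1.prod_right_ae, i2.prod_right_ae] with r h0 h1 h2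
  refine integral_mul_id_gaussianReal hv (fun x ↦ ?_) h0 h1 h2
  have hl : HasDerivAt (fun x : ℝ ↦ r + x • c) c x := by
    simpa using ((hasDerivAt_id x).smul_const c).const_add r
  exact (hg.1 _).hasFDerivAt.comp_hasDerivAt x hl

end IsIsonormal

/-! ### Uniqueness of the Malliavin derivative -/

namespace IsIsonormal

variable {Ω H : Type*} [MeasurableSpace Ω] [NormedAddCommGroup H] [InnerProductSpace ℝ H]
  {X : H → Ω → ℝ} {P : Measure Ω}

/-- With $L=Dg$, this turns $\langle DF,h\rangle$ into the directional derivative of $g$ along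
$(\langle k_i,h\rangle)_i$, the form produced by integration by parts. -/
theorem inner_sum_single_smul {ι : Type*} [Fintype ι] [DecidableEq ι] (L : (ι → ℝ) →L[ℝ] ℝ)
    (k : ι → H) (h : H) :
    inner ℝ (∑ i, L (Pi.single i 1) • k i) h = L fun i ↦ inner ℝ (k i) h := by
  rw [sum_inner, ← ContinuousLinearMap.coe_coe, LinearMap.pi_apply_eq_sum_univ (L : (ι → ℝ) →ₗ[ℝ] ℝ)]
  refine Finset.sum_congr rfl fun i _ ↦ ?_
  rw [real_inner_smul_left, smul_eq_mul, mul_comm]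
  congr 2
  funext j
  simp [Pi.single_apply, eq_comm]

/-- The product rule combined with Gaussian integration by parts. -/
theorem integral_mul_fderiv_add (hX : IsIsonormal X P) {ι κ : Type*} [Fintype ι] [Fintype κ]
    (k : ι → H) (l : κ → H) {g : (ι → ℝ) → ℝ} {u : (κ → ℝ) → ℝ} (hg : HasPolyGrowthDeriv g)
    (hu : HasPolyGrowthDeriv u) (h : H) :
    ∫ ω, u (fun j ↦ X (l j) ω) *
        fderiv ℝ g (fun i ↦ X (k i) ω) (fun i ↦ inner ℝ (k i) h) ∂P =
      ∫ ω, g (fun i ↦ X (k i) ω) * (u (fun j ↦ X (l j) ω) * X h ω -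
        fderiv ℝ u (fun j ↦ X (l j) ω) (fun j ↦ inner ℝ (l j) h)) ∂P := by
  -- Concatenating the two families makes $g$ and $u$ functions of a single Gaussian vector, so that
  -- their product can be integrated by parts.
  let L₁ : (ι ⊕ κ → ℝ) →L[ℝ] (ι → ℝ) :=
    ContinuousLinearMap.pi fun i ↦ ContinuousLinearMap.proj (Sum.inl i)
  let L₂ : (ι ⊕ κ → ℝ) →L[ℝ] (κ → ℝ) :=
    ContinuousLinearMap.pi fun i ↦ ContinuousLinearMap.proj (Sum.inr i)
  have hq := (hg.comp_clm L₁).mul (hu.comp_clm L₂)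
  have key := hX.integral_mul_eq (Sum.elim k l) hq h
  have e : ∀ x c, fderiv ℝ (fun x ↦ g (L₁ x) * u (L₂ x)) x c =
      g (L₁ x) * fderiv ℝ u (L₂ x) (L₂ c) + u (L₂ x) * fderiv ℝ g (L₁ x) (L₁ c) := by
    intro x c
    have h1 : HasFDerivAt (fun x ↦ g (L₁ x)) ((fderiv ℝ g (L₁ x)).comp L₁) x :=
      (hg.1 (L₁ x)).hasFDerivAt.comp x L₁.hasFDerivAt
    have h2 : HasFDerivAt (fun x ↦ u (L₂ x)) ((fderiv ℝ u (L₂ x)).comp L₂) x :=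
      (hu.1 (L₂ x)).hasFDerivAt.comp x L₂.hasFDerivAt
    rw [(h1.fun_mul h2).fderiv]
    simp
  simp only [e] at key
  have a1 : ∀ ω, L₁ (fun i ↦ X (Sum.elim k l i) ω) = fun i ↦ X (k i) ω := fun ω ↦ rfl
  have a2 : ∀ ω, L₂ (fun i ↦ X (Sum.elim k l i) ω) = fun i ↦ X (l i) ω := fun ω ↦ rfl
  have a3 : L₁ (fun i ↦ inner ℝ (Sum.elim k l i) h) = fun i ↦ inner ℝ (k i) h := rfl
  have a4 : L₂ (fun i ↦ inner ℝ (Sum.elim k l i) h) = fun i ↦ inner ℝ (l i) h := rfl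
  simp only [a1, a2, a3, a4] at key
  have mg := hg.memLp hX k (p := 2) (by simp)
  have mu := hu.memLp hX l (p := 2) (by simp)
  have mg' := hg.memLp_fderiv hX k (fun i ↦ inner ℝ (k i) h) (p := 2) (by simp)
  have mu' := hu.memLp_fderiv hX l (fun i ↦ inner ℝ (l i) h) (p := 2) (by simp)
  have i1 : Integrable (fun ω ↦ g (fun i ↦ X (k i) ω) *
      fderiv ℝ u (fun j ↦ X (l j) ω) (fun j ↦ inner ℝ (l j) h)) P := mg.integrable_mul mu'
  have i2 : Integrable (fun ω ↦ u (fun j ↦ X (l j) ω) *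
      fderiv ℝ g (fun i ↦ X (k i) ω) (fun i ↦ inner ℝ (k i) h)) P := mu.integrable_mul mg'
  have i3 : Integrable (fun ω ↦ (g (fun i ↦ X (k i) ω) * u (fun j ↦ X (l j) ω)) * X h ω) P := by
    have hq' := hq.memLp hX (Sum.elim k l) (p := 2) (by simp)
    exact hq'.integrable_mul (hX.memLp h (p := 2) (by simp))
  rw [integral_add i1 i2] at key
  have e2 : ∫ ω, g (fun i ↦ X (k i) ω) * (u (fun j ↦ X (l j) ω) * X h ω -
        fderiv ℝ u (fun j ↦ X (l j) ω) (fun j ↦ inner ℝ (l j) h)) ∂P =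
      ∫ ω, (g (fun i ↦ X (k i) ω) * u (fun j ↦ X (l j) ω)) * X h ω ∂P -
      ∫ ω, g (fun i ↦ X (k i) ω) *
        fderiv ℝ u (fun j ↦ X (l j) ω) (fun j ↦ inner ℝ (l j) h) ∂P := by
    rw [← integral_sub i3 i1]
    congr 1
    funext ω
    ring
  rw [e2, key]
  simp

theorem memLp_smul_const {f : Ω → ℝ} (hf : MemLp f 2 P) (h : H) :
    MemLp (fun ω ↦ f ω • h) 2 P :=
  (hf.norm.mul_const ‖h‖).of_le (hf.aestronglyMeasurable.smul_const h)
    (Filter.Eventually.of_forall fun ω ↦ by simp [norm_smul])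

/-- The divergence of `u(X(l)) h`, for a smooth cylindrical `u(X(l))`. -/
theorem memLp_divergence (hX : IsIsonormal X P) {κ : Type*} [Fintype κ] (l : κ → H)
    {u : (κ → ℝ) → ℝ} (hu : HasPolyGrowthDeriv u) (h : H) :
    MemLp (fun ω ↦ u (fun j ↦ X (l j) ω) * X h ω -
      fderiv ℝ u (fun j ↦ X (l j) ω) (fun j ↦ inner ℝ (l j) h)) 2 P := by
  refine MemLp.sub ?_ (hu.memLp_fderiv hX l _ (by simp))
  have : ENNReal.HolderTriple 4 4 2 := ⟨by
    rw [← two_mul, show (4 : ℝ≥0∞) = 2 * 2 by norm_num,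
      ENNReal.mul_inv (by simp) (by simp), ← mul_assoc,
      ENNReal.mul_inv_cancel (by simp) (by simp), one_mul]⟩
  exact (hX.memLp h (p := 4) (by simp)).mul (hu.memLp hX l (p := 4) (by simp))

/-- The duality between the Malliavin derivative and the divergence. -/
theorem inner_malliavin (hX : IsIsonormal X P) {κ : Type*} [Fintype κ] (l : κ → H)
    {u : (κ → ℝ) → ℝ} (hu : HasPolyGrowthDeriv u) (h : H) {F : Lp ℝ 2 P} {DF : Lp H 2 P}
    (hF : IsMalliavinDerivative X P F DF) :
    inner ℝ ((memLp_smul_const (hu.memLp hX l (p := 2) (by simp)) h).toLp _) DF =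
      inner ℝ ((hX.memLp_divergence l hu h).toLp _) F := by
  -- Both pairings are continuous in $(F,DF)$, so the identity need only be checked on the
  -- cylindrical graph.
  have hcl : IsClosed {p : Lp ℝ 2 P × Lp H 2 P |
      inner ℝ ((memLp_smul_const (hu.memLp hX l (p := 2) (by simp)) h).toLp _) p.2 =
        inner ℝ ((hX.memLp_divergence l hu h).toLp _) p.1} :=
    isClosed_eq (by fun_prop) (by fun_prop)
  refine closure_minimal (fun p hp ↦ ?_) hcl hF
  obtain ⟨n, k, g, hg, h1, h2⟩ := hp
  rw [Set.mem_ofPred_eq, L2.inner_def, L2.inner_def]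
  refine Eq.trans ?_ ((hX.integral_mul_fderiv_add k l (.of_hasTemperateGrowth hg) hu h).trans ?_)
  · refine integral_congr_ae ?_
    filter_upwards [h2, (memLp_smul_const (hu.memLp hX l (p := 2) (by simp)) h).coeFn_toLp]
      with ω e1 e2
    rw [e1, e2, real_inner_smul_left, real_inner_comm, inner_sum_single_smul]
  · refine integral_congr_ae ?_
    filter_upwards [h1, (hX.memLp_divergence l hu h).coeFn_toLp] with ω e1 e2
    rw [e1, e2]
    simp [mul_comm]

/-- The closure of the Malliavin derivative is single-valued. -/
theorem malliavin_unique (hX : IsIsonormal X P) {F : Lp ℝ 2 P} {D₁ D₂ : Lp H 2 P}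
    (h₁ : IsMalliavinDerivative X P F D₁) (h₂ : IsMalliavinDerivative X P F D₂) : D₁ = D₂ := by
  -- By duality, $D_1$ and $D_2$ have the same pairing with every cylindrical field $u\,h$, hence
  -- with every derivative in the graph and its closure. As $D_1$ and $D_2$ are themselves such
  -- derivatives, $D_1-D_2$ is orthogonal to itself. No density of cylindrical fields in
  -- $L^2(\Omega;H)$ is needed.
  have horth : ∀ p ∈ closure (cylindricalMalliavinGraph X P), inner ℝ p.2 (D₁ - D₂) = 0 := by
    have hcl : IsClosed {p : Lp ℝ 2 P × Lp H 2 P | inner ℝ p.2 (D₁ - D₂) = 0} :=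
      isClosed_eq (by fun_prop) (by fun_prop)
    refine fun p hp ↦ closure_minimal (fun p hp ↦ ?_) hcl hp
    obtain ⟨n, k, g, hg, -, h2⟩ := hp
    have hu : ∀ i, HasPolyGrowthDeriv fun x : Fin n → ℝ ↦ fderiv ℝ g x (Pi.single i 1) :=
      fun i ↦ .of_hasTemperateGrowth_fderiv hg _
    have e : p.2 = ∑ i, (memLp_smul_const ((hu i).memLp hX k (p := 2) (by simp)) (k i)).toLp _ := by
      apply Lp.ext
      have hs : ∀ᵐ ω ∂P, ∀ i, (memLp_smul_const ((hu i).memLp hX k (p := 2) (by simp))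
          (k i)).toLp _ ω = fderiv ℝ g (fun j ↦ X (k j) ω) (Pi.single i 1) • k i :=
        ae_all_iff.2 fun i ↦ MemLp.coeFn_toLp _
      filter_upwards [h2, hs, Lp.coeFn_finsetSum Finset.univ (fun i ↦
        (memLp_smul_const ((hu i).memLp hX k (p := 2) (by simp)) (k i)).toLp _)]
        with ω e1 e2 e3
      rw [e1, e3]
      simp [e2]
    rw [Set.mem_ofPred_eq, e, sum_inner]
    refine Finset.sum_eq_zero fun i _ ↦ ?_
    rw [inner_sub_right, hX.inner_malliavin k (hu i) (k i) h₁,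
      hX.inner_malliavin k (hu i) (k i) h₂, sub_self]
  have : inner ℝ (D₁ - D₂) (D₁ - D₂) = 0 := by
    rw [inner_sub_left, horth _ h₁, horth _ h₂, sub_zero]
  exact sub_eq_zero.1 (inner_self_eq_zero.1 this)

/-! ### The derivative of a double integral -/

theorem memLp_smul (hX : IsIsonormal X P) (h k : H) : MemLp (fun ω ↦ X h ω • k) 2 P :=
  memLp_smul_const (hX.memLp h (by simp)) k

/-- `X(h) k` as an element of `L²(Ω; H)`. -/
noncomputable def smulLp (hX : IsIsonormal X P) (h k : H) : Lp H 2 P :=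
  (hX.memLp_smul h k).toLp _

theorem coeFn_smulLp (hX : IsIsonormal X P) (h k : H) :
    hX.smulLp h k =ᵐ[P] fun ω ↦ X h ω • k :=
  (hX.memLp_smul h k).coeFn_toLp

/-- The linear map `H ⊗ H → L²(Ω; H)` which sends `h ⊗ k` to `X(h) k`. -/
noncomputable def partialTensor (hX : IsIsonormal X P) : H ⊗[ℝ] H →ₗ[ℝ] Lp H 2 P :=
  TensorProduct.lift <| LinearMap.mk₂ ℝ hX.smulLp
    (fun h h' k ↦ by
      apply Lp.ext
      filter_upwards [hX.coeFn_smulLp (h + h') k, hX.coeFn_smulLp h k, hX.coeFn_smulLp h' k,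
        Lp.coeFn_add (hX.smulLp h k) (hX.smulLp h' k), hX.map_add_ae h h'] with ω h1 h2 h3 h4 h5
      rw [h1, h4, Pi.add_apply, h2, h3, h5, add_smul])
    (fun c h k ↦ by
      apply Lp.ext
      filter_upwards [hX.coeFn_smulLp (c • h) k, hX.coeFn_smulLp h k,
        Lp.coeFn_smul c (hX.smulLp h k), hX.map_smul_ae c h] with ω h1 h2 h4 h5
      rw [h1, h4, Pi.smul_apply, h2, h5, mul_smul])
    (fun h k k' ↦ by
      apply Lp.ext
      filter_upwards [hX.coeFn_smulLp h (k + k'), hX.coeFn_smulLp h k, hX.coeFn_smulLp h k',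
        Lp.coeFn_add (hX.smulLp h k) (hX.smulLp h k')] with ω h1 h2 h3 h4
      rw [h1, h4, Pi.add_apply, h2, h3, smul_add])
    (fun c h k ↦ by
      apply Lp.ext
      filter_upwards [hX.coeFn_smulLp h (c • k), hX.coeFn_smulLp h k,
        Lp.coeFn_smul c (hX.smulLp h k)] with ω h1 h2 h4
      rw [h1, h4, Pi.smul_apply, h2, smul_comm])

theorem partialTensor_tmul (hX : IsIsonormal X P) (h k : H) :
    hX.partialTensor (h ⊗ₜ k) = hX.smulLp h k := rfl

/-- $E[X(h)X(l)]\langle k,m\rangle$ is exactly the inner product of $h\otimes k$ and $l\otimes m$.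
Isometry gives the bound needed to extend to the completion. -/
theorem inner_partialTensor (hX : IsIsonormal X P) (x y : H ⊗[ℝ] H) :
    inner ℝ (hX.partialTensor x) (hX.partialTensor y) = inner ℝ x y := by
  induction x using TensorProduct.induction_on with
  | zero => simp
  | add x x' hx hx' => rw [map_add, inner_add_left, hx, hx', inner_add_left]
  | tmul h k =>
    induction y using TensorProduct.induction_on with
    | zero => simp
    | add y y' hy hy' => rw [map_add, inner_add_right, hy, hy', inner_add_right]
    | tmul l m =>
      rw [partialTensor_tmul, partialTensor_tmul, L2.inner_def]
      have e : (fun ω ↦ inner ℝ (hX.smulLp h k ω) (hX.smulLp l m ω)) =ᵐ[P] fun ω ↦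
          (X h ω * X l ω) * inner ℝ k m := by
        filter_upwards [hX.coeFn_smulLp h k, hX.coeFn_smulLp l m] with ω h1 h2
        rw [h1, h2, real_inner_smul_left, real_inner_smul_right]
        ring
      rw [integral_congr_ae e, integral_mul_const, hX.covariance_eq, TensorProduct.inner_tmul]

theorem norm_partialTensor_le (hX : IsIsonormal X P) (x : H ⊗[ℝ] H) :
    ‖hX.partialTensor x‖ ≤ 1 * ‖x‖ := by
  have h1 := hX.inner_partialTensor x x
  rw [real_inner_self_eq_norm_sq, real_inner_self_eq_norm_sq x] at h1
  rw [one_mul]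
  exact (abs_le_of_sq_le_sq' h1.le (norm_nonneg _)).2

/-- `wickTensor` and `partialTensor` on a finite linear combination of squares. -/
theorem coeFn_wickTensor_sum (hX : IsIsonormal X P) {n : ℕ} (c : Fin n → ℝ) (k : Fin n → H) :
    hX.wickTensor (∑ i, c i • (k i ⊗ₜ k i)) =ᵐ[P]
      fun ω ↦ ∑ i, c i * (X (k i) ω ^ 2 - ‖k i‖ ^ 2) := by
  rw [map_sum]
  have h1 : ∀ᵐ ω ∂P, ∀ i, hX.wickTensor (c i • (k i ⊗ₜ k i)) ω =
      c i * (X (k i) ω ^ 2 - ‖k i‖ ^ 2) := by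
    refine ae_all_iff.2 fun i ↦ ?_
    rw [map_smul, wickTensor_tmul]
    filter_upwards [Lp.coeFn_smul (c i) (hX.wickMul (k i) (k i)), hX.coeFn_wickMul (k i) (k i)]
      with ω e1 e2
    rw [e1, Pi.smul_apply, e2, real_inner_self_eq_norm_sq, smul_eq_mul, sq (X (k i) ω)]
  filter_upwards [h1, Lp.coeFn_finsetSum Finset.univ (fun i ↦ hX.wickTensor (c i • (k i ⊗ₜ k i)))] with ω e1 e2
  rw [e2, Finset.sum_apply]
  exact Finset.sum_congr rfl fun i _ ↦ e1 i

theorem coeFn_two_smul_partialTensor_sum (hX : IsIsonormal X P) {n : ℕ} (c : Fin n → ℝ)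
    (k : Fin n → H) : ((2 : ℝ) • hX.partialTensor (∑ i, c i • (k i ⊗ₜ k i)) : Lp H 2 P) =ᵐ[P]
      fun ω ↦ ∑ i, (2 * c i * X (k i) ω) • k i := by
  rw [map_sum, Finset.smul_sum]
  have h1 : ∀ᵐ ω ∂P, ∀ i, ((2 : ℝ) • hX.partialTensor (c i • (k i ⊗ₜ k i)) : Lp H 2 P) ω =
      (2 * c i * X (k i) ω) • k i := by
    refine ae_all_iff.2 fun i ↦ ?_
    rw [map_smul, partialTensor_tmul, smul_smul]
    filter_upwards [Lp.coeFn_smul (2 * c i) (hX.smulLp (k i) (k i)), hX.coeFn_smulLp (k i) (k i)]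
      with ω e1 e2
    rw [e1, Pi.smul_apply, e2, smul_smul]
  filter_upwards [h1, Lp.coeFn_finsetSum Finset.univ (fun i ↦
    ((2 : ℝ) • hX.partialTensor (c i • (k i ⊗ₜ k i)) : Lp H 2 P))] with ω e1 e2
  rw [e2, Finset.sum_apply]
  exact Finset.sum_congr rfl fun i _ ↦ e1 i

/-- The polynomial `x ↦ ∑ cᵢ (xᵢ² - vᵢ)`. -/
theorem hasTemperateGrowth_quadratic {n : ℕ} (c v : Fin n → ℝ) :
    Function.HasTemperateGrowth fun x : Fin n → ℝ ↦ ∑ i, c i * (x i ^ 2 - v i) := by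
  have h : ∀ i : Fin n, Function.HasTemperateGrowth fun x : Fin n → ℝ ↦ x i := fun i ↦
    (ContinuousLinearMap.proj (R := ℝ) (φ := fun _ : Fin n ↦ ℝ) i).hasTemperateGrowth
  refine .sum fun i _ ↦ ?_
  exact (Function.HasTemperateGrowth.const (c i)).fun_mul
    (((h i).fun_pow 2).fun_sub (.const (v i)))

theorem fderiv_quadratic {n : ℕ} (c v : Fin n → ℝ) (x w : Fin n → ℝ) :
    fderiv ℝ (fun x : Fin n → ℝ ↦ ∑ i, c i * (x i ^ 2 - v i)) x w =
      ∑ i, 2 * c i * x i * w i := by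
  have : HasFDerivAt (fun x : Fin n → ℝ ↦ ∑ i, c i * (x i ^ 2 - v i))
      (∑ i, c i • ((2 * x i) • (ContinuousLinearMap.proj i : (Fin n → ℝ) →L[ℝ] ℝ))) x := by
    refine HasFDerivAt.fun_sum fun i _ ↦ HasFDerivAt.const_mul ?_ (c i)
    have := ((hasFDerivAt_apply (𝕜 := ℝ) i x).pow 2).sub_const (v i)
    simpa using this
  rw [this.fderiv]
  simp only [sum_apply, smul_apply,
    ContinuousLinearMap.proj_apply, smul_eq_mul]
  exact Finset.sum_congr rfl fun i _ ↦ by ring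

/-- The witness is the quadratic polynomial $\sum_i c_i(x_i^2-\|k_i\|^2)$; the factor 2 is that of
$D(X(k)^2)=2X(k)k$. -/
theorem wickTensor_mem_graph (hX : IsIsonormal X P) {n : ℕ} (c : Fin n → ℝ) (k : Fin n → H) :
    (hX.wickTensor (∑ i, c i • (k i ⊗ₜ k i)),
      (2 : ℝ) • hX.partialTensor (∑ i, c i • (k i ⊗ₜ k i))) ∈ cylindricalMalliavinGraph X P := by
  refine ⟨n, k, _, hasTemperateGrowth_quadratic c fun i ↦ ‖k i‖ ^ 2,
    hX.coeFn_wickTensor_sum c k, ?_⟩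
  filter_upwards [hX.coeFn_two_smul_partialTensor_sum c k] with ω hω
  rw [hω]
  refine Finset.sum_congr rfl fun i _ ↦ ?_
  rw [fderiv_quadratic]
  congr 1
  rw [Finset.sum_eq_single i (fun j _ hj ↦ by simp [hj]) (by simp)]
  simp

theorem tendsto_extend {E : Type*} [NormedAddCommGroup E] [NormedSpace ℝ E] [CompleteSpace E]
    (T : H ⊗[ℝ] H →L[ℝ] E) {y : ℕ → H ⊗[ℝ] H} {z : ℕ → HilbertTensorSquare H}
    {f : HilbertTensorSquare H} (hz : Filter.Tendsto z Filter.atTop (nhds f))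
    (hy : ∀ m, UniformSpace.Completion.toComplL (𝕜 := ℝ) (y m) = z m) :
    Filter.Tendsto (fun m ↦ T (y m)) Filter.atTop
      (nhds (T.extend (UniformSpace.Completion.toComplL : H ⊗[ℝ] H →L[ℝ] HilbertTensorSquare H)
        f)) := by
  have h1 := ((T.extend (UniformSpace.Completion.toComplL :
    H ⊗[ℝ] H →L[ℝ] HilbertTensorSquare H)).continuous.tendsto f).comp hz
  refine h1.congr fun m ↦ ?_
  rw [Function.comp_apply, ← hy m]
  exact T.extend_eq UniformSpace.Completion.denseRange_coe
    (UniformSpace.Completion.isUniformInducing_coe _) (y m)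

/-- A double integral and its Malliavin derivative are limits of finite linear combinations of
the variables `X(k)² - ‖k‖²` and of their derivatives `2 X(k) k`. -/
theorem exists_tendsto_doubleIntegral [CompleteSpace H] (hX : IsIsonormal X P)
    (f : symmetricTensorSquare H)
    {DZ : Lp H 2 P} (hDZ : IsMalliavinDerivative X P (hX.doubleIntegral f) DZ) :
    ∃ y : ℕ → H ⊗[ℝ] H,
      (∀ m, ∃ (n : ℕ) (c : Fin n → ℝ) (k : Fin n → H), y m = ∑ i, c i • (k i ⊗ₜ k i)) ∧
      Filter.Tendsto (fun m ↦ hX.wickTensor (y m)) Filter.atTop (nhds (hX.doubleIntegral f)) ∧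
      Filter.Tendsto (fun m ↦ (2 : ℝ) • hX.partialTensor (y m)) Filter.atTop (nhds DZ) := by
  obtain ⟨f, hf⟩ := f
  obtain ⟨z, hz, hzf⟩ := mem_closure_iff_seq_limit.1 hf
  have hy : ∀ m, ∃ y : H ⊗[ℝ] H, (∃ (n : ℕ) (c : Fin n → ℝ) (k : Fin n → H),
      y = ∑ i, c i • (k i ⊗ₜ k i)) ∧
      UniformSpace.Completion.toComplL (𝕜 := ℝ) y = z m := by
    intro m
    obtain ⟨n, c, g, hg⟩ := Submodule.mem_span_set'.1 (hz m)
    choose k hk using fun i ↦ (g i).2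
    refine ⟨_, ⟨n, c, k, rfl⟩, ?_⟩
    rw [map_sum, ← hg]
    refine Finset.sum_congr rfl fun i _ ↦ ?_
    rw [map_smul, ← hk i]
    rfl
  choose y hy1 hy2 using hy
  have t1 : Filter.Tendsto (fun m ↦ hX.wickTensor (y m)) Filter.atTop
      (nhds (hX.doubleIntegral ⟨f, hf⟩)) :=
    tendsto_extend (hX.wickTensor.mkContinuous 2 hX.norm_wickTensor_le) hzf hy2
  have t2 := (tendsto_extend (hX.partialTensor.mkContinuous 1 hX.norm_partialTensor_le)
    hzf hy2).const_smul (2 : ℝ)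
  -- The limit of the approximating pairs lies in the closed graph, so it provides one derivative of
  -- $Z$; uniqueness then identifies it with the given $DZ$.
  have hD : IsMalliavinDerivative X P (hX.doubleIntegral ⟨f, hf⟩)
      ((2 : ℝ) • (hX.partialTensor.mkContinuous 1 hX.norm_partialTensor_le).extend
        UniformSpace.Completion.toComplL f) := by
    refine mem_closure_of_tendsto (t1.prodMk_nhds t2) (Filter.Eventually.of_forall fun m ↦ ?_)
    obtain ⟨n, c, k, h⟩ := hy1 m
    simp only [LinearMap.mkContinuous_apply]
    rw [h]
    exact hX.wickTensor_mem_graph c k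
  rw [hX.malliavin_unique hDZ hD]
  exact ⟨y, hy1, t1, t2⟩

end IsIsonormal

/-! ### Integration by parts for functions of a double integral -/

theorem HasPolyGrowthDeriv.comp_of_bounded_deriv {E : Type*} [NormedAddCommGroup E]
    [NormedSpace ℝ E] {g : E → ℝ} (hg : HasPolyGrowthDeriv g) {φ ψ : ℝ → ℝ} {C : ℝ}
    (hφ : ∀ x, HasDerivAt φ (ψ x) x) (hφC : ∀ x, ‖φ x - φ 0‖ ≤ C * ‖x‖)
    (hψ : ∀ x, ‖ψ x‖ ≤ C) : HasPolyGrowthDeriv fun x ↦ φ (g x) := by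
  obtain ⟨hd, B, N, h⟩ := hg
  have hC : 0 ≤ C := (norm_nonneg _).trans (hψ 0)
  have hB : 0 ≤ B := by simpa using (norm_nonneg _).trans (h 0).1
  have hder : ∀ x, HasFDerivAt (fun x ↦ φ (g x)) (ψ (g x) • fderiv ℝ g x) x := fun x ↦
    (hφ (g x)).comp_hasFDerivAt x (hd x).hasFDerivAt
  refine ⟨fun x ↦ (hder x).differentiableAt, C * B + ‖φ 0‖, N, fun x ↦ ?_⟩
  have h1 : 1 ≤ (1 + ‖x‖) ^ N := one_le_pow₀ (by linarith [norm_nonneg x])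
  constructor
  · calc ‖φ (g x)‖ = ‖φ (g x) - φ 0 + φ 0‖ := by rw [sub_add_cancel]
      _ ≤ C * ‖g x‖ + ‖φ 0‖ := (norm_add_le _ _).trans (add_le_add_left (hφC _) _)
      _ ≤ C * (B * (1 + ‖x‖) ^ N) + ‖φ 0‖ * (1 + ‖x‖) ^ N :=
        add_le_add (mul_le_mul_of_nonneg_left (h x).1 hC)
          (le_mul_of_one_le_right (norm_nonneg _) h1)
      _ = _ := by ring
  · rw [(hder x).fderiv, norm_smul]
    calc ‖ψ (g x)‖ * ‖fderiv ℝ g x‖ ≤ C * (B * (1 + ‖x‖) ^ N) :=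
        mul_le_mul (hψ _) (h x).2 (norm_nonneg _) hC
      _ ≤ (C * B) * (1 + ‖x‖) ^ N + ‖φ 0‖ * (1 + ‖x‖) ^ N := by
        rw [mul_assoc]
        exact le_add_of_nonneg_right (by positivity)
      _ = _ := by ring

theorem lipschitzWith_of_hasDerivAt {φ ψ : ℝ → ℝ} {C : ℝ} (hφ : ∀ x, HasDerivAt φ (ψ x) x)
    (hψ : ∀ x, ‖ψ x‖ ≤ C) : LipschitzWith C.toNNReal φ :=
  lipschitzWith_of_nnnorm_deriv_le (fun x ↦ (hφ x).differentiableAt) fun x ↦ by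
    rw [(hφ x).deriv, ← NNReal.coe_le_coe, coe_nnnorm]
    exact (hψ x).trans (Real.le_coe_toNNReal C)

/-- The factors are separated: $\|D_m\|^2\to\|D_0\|^2$ in $L^1$ while $\psi$ stays bounded, and with
$\|D_0\|^2$ fixed, dominated convergence handles $\psi(Z_m)\to\psi(Z_0)$. -/
theorem tendsto_integral_mul_norm_sq {Ω H : Type*} [MeasurableSpace Ω] [NormedAddCommGroup H]
    [InnerProductSpace ℝ H] {P : Measure Ω} {Z : ℕ → Lp ℝ 2 P} {Z₀ : Lp ℝ 2 P}
    {D : ℕ → Lp H 2 P} {D₀ : Lp H 2 P}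
    (hZ : ∀ᵐ ω ∂P, Filter.Tendsto (fun m ↦ Z m ω) Filter.atTop (nhds (Z₀ ω)))
    (hD : Filter.Tendsto D Filter.atTop (nhds D₀)) {ψ : ℝ → ℝ} (hψc : Continuous ψ) {C : ℝ}
    (hψ : ∀ x, ‖ψ x‖ ≤ C) :
    Filter.Tendsto (fun m ↦ ∫ ω, ψ (Z m ω) * ‖D m ω‖ ^ 2 ∂P) Filter.atTop
      (nhds (∫ ω, ψ (Z₀ ω) * ‖D₀ ω‖ ^ 2 ∂P)) := by
  have hC : 0 ≤ C := (norm_nonneg _).trans (hψ 0)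
  -- The squared norm is realised through the bounded bilinear Hölder pairing $L^2\times L^2\to
  -- L^1$, which makes it continuous in $D$.
  let W : Lp H 2 P → Lp ℝ 1 P := fun D ↦ (innerSL ℝ).holder 1 D D
  have hW : ∀ D, W D =ᵐ[P] fun ω ↦ ‖D ω‖ ^ 2 := fun D ↦ by
    filter_upwards [(innerSL ℝ).coeFn_holder (r := 1) D D] with ω hω
    rw [hω, innerSL_apply_apply, real_inner_self_eq_norm_sq]
  have hWc : Continuous W := by
    have := ((innerSL ℝ (E := H)).holderL P 2 2 1).isBoundedBilinearMap.continuous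
    exact this.comp (continuous_id.prodMk continuous_id)
  have e : ∀ (Z : Lp ℝ 2 P) (D : Lp H 2 P), ∫ ω, ψ (Z ω) * ‖D ω‖ ^ 2 ∂P =
      ∫ ω, ψ (Z ω) * W D ω ∂P := fun Z D ↦ by
    refine integral_congr_ae ?_
    filter_upwards [hW D] with ω hω
    rw [hω]
  simp only [e]
  have hWi : ∀ D, Integrable (W D) P := fun D ↦ L1.integrable_coeFn _
  have hψm : ∀ Z : Lp ℝ 2 P, AEStronglyMeasurable (fun ω ↦ ψ (Z ω)) P := fun Z ↦
    hψc.comp_aestronglyMeasurable (Lp.aestronglyMeasurable Z)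
  have hint : ∀ (Z : Lp ℝ 2 P) {w : Ω → ℝ}, Integrable w P →
      Integrable (fun ω ↦ ψ (Z ω) * w ω) P := fun Z w hw ↦
    hw.bdd_mul (hψm Z) (Filter.Eventually.of_forall fun ω ↦ hψ _)
  have t1 : Filter.Tendsto (fun m ↦ ∫ ω, ψ (Z m ω) * W D₀ ω ∂P) Filter.atTop
      (nhds (∫ ω, ψ (Z₀ ω) * W D₀ ω ∂P)) := by
    refine tendsto_integral_of_dominated_convergence (fun ω ↦ C * ‖W D₀ ω‖)
      (fun m ↦ (hint (Z m) (hWi D₀)).aestronglyMeasurable) ((hWi D₀).norm.const_mul C)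
      (fun m ↦ Filter.Eventually.of_forall fun ω ↦ ?_) ?_
    · rw [norm_mul]
      exact mul_le_mul_of_nonneg_right (hψ _) (norm_nonneg _)
    · filter_upwards [hZ] with ω hω
      exact ((hψc.tendsto _).comp hω).mul_const _
  have t2 : Filter.Tendsto (fun m ↦ ∫ ω, ψ (Z m ω) * W (D m) ω ∂P - ∫ ω, ψ (Z m ω) * W D₀ ω ∂P)
      Filter.atTop (nhds 0) := by
    have t3 : Filter.Tendsto (fun m ↦ C * ‖W (D m) - W D₀‖) Filter.atTop (nhds 0) := by
      have := (tendsto_iff_norm_sub_tendsto_zero.1 ((hWc.tendsto D₀).comp hD)).const_mul C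
      simpa using this
    refine squeeze_zero_norm (fun m ↦ ?_) t3
    rw [← integral_sub (hint (Z m) (hWi _)) (hint (Z m) (hWi _)), L1.norm_eq_integral_norm,
      ← integral_const_mul]
    refine (norm_integral_le_integral_norm _).trans (integral_mono_ae ?_ ?_ ?_)
    · exact ((hint (Z m) (hWi _)).sub (hint (Z m) (hWi _))).norm
    · exact (L1.integrable_coeFn _).norm.const_mul C
    · filter_upwards [Lp.coeFn_sub (W (D m)) (W D₀)] with ω hω
      rw [hω, Pi.sub_apply, ← mul_sub, norm_mul]
      exact mul_le_mul_of_nonneg_right (hψ _) (norm_nonneg _)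
  have := t2.add t1
  simpa using this

namespace IsIsonormal

variable {Ω H : Type*} [MeasurableSpace Ω] [NormedAddCommGroup H] [InnerProductSpace ℝ H]
  {X : H → Ω → ℝ} {P : Measure Ω}

/-- Integrate $x_j\varphi(q(x))$ by parts in the direction $k_j$. Differentiating $x_j$ gives
$\|k_j\|^2\varphi(q)$, which cancels the Wick correction; the other terms, weighted by $c_j$ and
summed, form half of $\psi(q)\|DZ\|^2$. -/
theorem integral_wickTensor_mul (hX : IsIsonormal X P) {n : ℕ} (c : Fin n → ℝ) (k : Fin n → H)
    {φ ψ : ℝ → ℝ} {C : ℝ} (hφ : ∀ x, HasDerivAt φ (ψ x) x) (hψ : ∀ x, ‖ψ x‖ ≤ C) :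
    ∫ ω, hX.wickTensor (∑ i, c i • (k i ⊗ₜ k i)) ω *
        φ (hX.wickTensor (∑ i, c i • (k i ⊗ₜ k i)) ω) ∂P =
      (∫ ω, ψ (hX.wickTensor (∑ i, c i • (k i ⊗ₜ k i)) ω) *
        ‖((2 : ℝ) • hX.partialTensor (∑ i, c i • (k i ⊗ₜ k i)) : Lp H 2 P) ω‖ ^ 2 ∂P) / 2 := by
  set q : (Fin n → ℝ) → ℝ := fun x ↦ ∑ i, c i * (x i ^ 2 - ‖k i‖ ^ 2) with hq
  have hqt : HasPolyGrowthDeriv q := .of_hasTemperateGrowth (hasTemperateGrowth_quadratic _ _)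
  have hφq : HasPolyGrowthDeriv fun x ↦ φ (q x) := by
    refine hqt.comp_of_bounded_deriv hφ (C := C) (fun x ↦ ?_) hψ
    have := (lipschitzWith_of_hasDerivAt hφ hψ).dist_le_mul x 0
    rwa [dist_eq_norm, dist_eq_norm, sub_zero,
      Real.coe_toNNReal _ ((norm_nonneg _).trans (hψ 0))] at this
  have hprojt : ∀ j : Fin n, HasPolyGrowthDeriv fun x : Fin n → ℝ ↦ x j := fun j ↦
    .of_hasTemperateGrowth
      (ContinuousLinearMap.proj (R := ℝ) (φ := fun _ : Fin n ↦ ℝ) j).hasTemperateGrowth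
  have hprod : ∀ j, HasPolyGrowthDeriv fun x : Fin n → ℝ ↦ x j * φ (q x) :=
    fun j ↦ (hprojt j).mul hφq
  have hder : ∀ j x w, fderiv ℝ (fun x : Fin n → ℝ ↦ x j * φ (q x)) x w =
      φ (q x) * w j + x j * (ψ (q x) * ∑ i, 2 * c i * x i * w i) := by
    intro j x w
    have h1 : HasFDerivAt (fun x : Fin n → ℝ ↦ φ (q x)) (ψ (q x) • fderiv ℝ q x) x :=
      (hφ (q x)).comp_hasFDerivAt x (hqt.1 x).hasFDerivAt
    rw [((hasFDerivAt_apply (𝕜 := ℝ) j x).fun_mul h1).fderiv]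
    simp only [add_apply, smul_apply, smul_eq_mul, hq, fderiv_quadratic,
      ContinuousLinearMap.proj_apply]
    ring
  set Y : Ω → Fin n → ℝ := fun ω i ↦ X (k i) ω with hY
  have iφ := memLp_one_iff_integrable.1 (hφq.memLp hX k (p := 1) (by simp))
  have iXX : ∀ j, Integrable (fun ω ↦ Y ω j * φ (q (Y ω)) * X (k j) ω) P := fun j ↦
    ((hprod j).memLp hX k (p := 2) (by simp)).integrable_mul (hX.memLp (k j) (p := 2) (by simp))
  have step : ∀ j, Integrable (fun ω ↦ (Y ω j ^ 2 - ‖k j‖ ^ 2) * φ (q (Y ω))) P ∧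
      Integrable (fun ω ↦ Y ω j * (ψ (q (Y ω)) * ∑ i, 2 * c i * Y ω i * inner ℝ (k i) (k j))) P ∧
      ∫ ω, (Y ω j ^ 2 - ‖k j‖ ^ 2) * φ (q (Y ω)) ∂P =
        ∫ ω, Y ω j * (ψ (q (Y ω)) * ∑ i, 2 * c i * Y ω i * inner ℝ (k i) (k j)) ∂P := by
    intro j
    have key := hX.integral_mul_eq k (hprod j) (k j)
    have iD := memLp_one_iff_integrable.1
      ((hprod j).memLp_fderiv hX k (fun i ↦ inner ℝ (k i) (k j)) (p := 1) (by simp))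
    simp only [hder] at key iD
    have e1 : (fun ω ↦ (Y ω j ^ 2 - ‖k j‖ ^ 2) * φ (q (Y ω))) = fun ω ↦
        Y ω j * φ (q (Y ω)) * X (k j) ω - ‖k j‖ ^ 2 * φ (q (Y ω)) := by
      funext ω
      simp only [hY]
      ring
    have e2 : (fun ω ↦ Y ω j * (ψ (q (Y ω)) *
        ∑ i, 2 * c i * Y ω i * inner ℝ (k i) (k j))) = fun ω ↦
        (φ (q (Y ω)) * inner ℝ (k j) (k j) + Y ω j * (ψ (q (Y ω)) *
        ∑ i, 2 * c i * Y ω i * inner ℝ (k i) (k j))) - ‖k j‖ ^ 2 * φ (q (Y ω)) := by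
      funext ω
      rw [real_inner_self_eq_norm_sq]
      ring
    rw [e1, e2]
    refine ⟨(iXX j).sub (iφ.const_mul _), iD.sub (iφ.const_mul _), ?_⟩
    rw [integral_sub (iXX j) (iφ.const_mul _), integral_sub iD (iφ.const_mul _), key]
  have eL : ∫ ω, hX.wickTensor (∑ i, c i • (k i ⊗ₜ k i)) ω *
        φ (hX.wickTensor (∑ i, c i • (k i ⊗ₜ k i)) ω) ∂P =
      ∫ ω, ∑ j, c j * ((Y ω j ^ 2 - ‖k j‖ ^ 2) * φ (q (Y ω))) ∂P := by
    refine integral_congr_ae ?_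
    filter_upwards [hX.coeFn_wickTensor_sum c k] with ω hω
    rw [hω]
    simp only [hq, hY, Finset.sum_mul]
    exact Finset.sum_congr rfl fun i _ ↦ by ring
  have eR : ∫ ω, ψ (hX.wickTensor (∑ i, c i • (k i ⊗ₜ k i)) ω) *
        ‖((2 : ℝ) • hX.partialTensor (∑ i, c i • (k i ⊗ₜ k i)) : Lp H 2 P) ω‖ ^ 2 ∂P =
      ∫ ω, 2 * ∑ j, c j * (Y ω j * (ψ (q (Y ω)) *
        ∑ i, 2 * c i * Y ω i * inner ℝ (k i) (k j))) ∂P := by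
    refine integral_congr_ae ?_
    filter_upwards [hX.coeFn_wickTensor_sum c k, hX.coeFn_two_smul_partialTensor_sum c k]
      with ω h1 h2
    rw [h1, h2, ← real_inner_self_eq_norm_sq, inner_sum, Finset.mul_sum, Finset.mul_sum]
    refine Finset.sum_congr rfl fun j _ ↦ ?_
    rw [sum_inner]
    simp only [real_inner_smul_left, real_inner_smul_right, Finset.mul_sum]
    refine Finset.sum_congr rfl fun i _ ↦ ?_
    simp only [hq, hY]
    ring
  rw [eL, eR, integral_const_mul, mul_div_cancel_left₀ _ two_ne_zero,
    integral_finsetSum _ fun j _ ↦ (step j).1.const_mul (c j),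
    integral_finsetSum _ fun j _ ↦ (step j).2.1.const_mul (c j)]
  refine Finset.sum_congr rfl fun j _ ↦ ?_
  rw [integral_const_mul, integral_const_mul, (step j).2.2]

/-- Exhibits the left side as a continuous function of $Z\in L^2$: composition with a Lipschitz
function vanishing at $0$ is continuous on $L^2$, and the constant $\varphi(0)$ contributes a
multiple of the mean. -/
theorem integral_mul_eq_const_add [IsProbabilityMeasure P] (Z : Lp ℝ 2 P) {φ : ℝ → ℝ}
    {C : NNReal} (hφ : LipschitzWith C fun x ↦ φ x - φ 0) :
    ∫ ω, Z ω * φ (Z ω) ∂P = inner ℝ (hφ.compLp (sub_self _) Z) Z +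
      φ 0 * inner ℝ (indicatorConstLp 2 (μ := P) MeasurableSet.univ (by simp) (1 : ℝ)) Z := by
  rw [L2.inner_indicatorConstLp_one, L2.inner_def, ← integral_const_mul, setIntegral_univ,
    ← integral_add (L2.integrable_inner _ _)
      (((Lp.memLp Z).integrable (by norm_num)).const_mul (φ 0))]
  refine integral_congr_ae ?_
  filter_upwards [hφ.coeFn_compLp (sub_self _) Z] with ω hω
  rw [hω]
  simp only [Function.comp_apply, RCLike.inner_apply, conj_trivial]
  ring

/-- Integration by parts: `E[Z φ(Z)] = E[φ'(Z) ‖DZ‖²] / 2` for `Z` in the second chaos. -/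
theorem integral_doubleIntegral_mul [CompleteSpace H] (hX : IsIsonormal X P)
    (f : symmetricTensorSquare H) {DZ : Lp H 2 P}
    (hDZ : IsMalliavinDerivative X P (hX.doubleIntegral f) DZ) {φ ψ : ℝ → ℝ} {C : ℝ}
    (hφ : ∀ x, HasDerivAt φ (ψ x) x) (hψc : Continuous ψ) (hψ : ∀ x, ‖ψ x‖ ≤ C) :
    ∫ ω, hX.doubleIntegral f ω * φ (hX.doubleIntegral f ω) ∂P =
      (∫ ω, ψ (hX.doubleIntegral f ω) * ‖DZ ω‖ ^ 2 ∂P) / 2 := by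
  have hP := hX.isGaussianProcess.isProbabilityMeasure
  obtain ⟨y, hy, hZ, hD⟩ := hX.exists_tendsto_doubleIntegral f hDZ
  -- A subsequence is needed because the right side involves $\psi$, merely bounded and continuous,
  -- and uses almost sure convergence.
  obtain ⟨ns, hns, hae⟩ := (tendstoInMeasure_of_tendsto_Lp hZ).exists_seq_tendsto_ae
  have tR := (tendsto_integral_mul_norm_sq hae (hD.comp hns.tendsto_atTop) hψc hψ).div_const 2
  have hL : LipschitzWith C.toNNReal fun x ↦ φ x - φ 0 :=
    lipschitzWith_of_hasDerivAt (fun x ↦ (hφ x).sub_const (φ 0)) hψ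
  have tL : Filter.Tendsto (fun m ↦ ∫ ω, hX.wickTensor (y m) ω * φ (hX.wickTensor (y m) ω) ∂P)
      Filter.atTop (nhds (∫ ω, hX.doubleIntegral f ω * φ (hX.doubleIntegral f ω) ∂P)) := by
    simp only [integral_mul_eq_const_add _ hL]
    have hc : Continuous fun Z : Lp ℝ 2 P ↦ inner ℝ (hL.compLp (sub_self _) Z) Z +
        φ 0 * inner ℝ (indicatorConstLp 2 (μ := P) MeasurableSet.univ (by simp) (1 : ℝ)) Z :=
      ((hL.continuous_compLp (sub_self _)).inner continuous_id).add
        (continuous_const.mul (continuous_const.inner continuous_id))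
    exact (hc.tendsto _).comp hZ
  refine tendsto_nhds_unique ((tL.comp hns.tendsto_atTop).congr fun m ↦ ?_) tR
  obtain ⟨n, c, k, h⟩ := hy (ns m)
  simp only [Function.comp_apply]
  rw [h]
  exact hX.integral_wickTensor_mul c k hφ hψ

end IsIsonormal

/-! ### Tail bounds from integration by parts -/

/-- A bounded above, concave, `C¹` truncation of the identity. -/
noncomputable def softTruncation (K z : ℝ) : ℝ := if z ≤ 0 then z else K * z / (K + z)

/-- The derivative of `softTruncation`. -/
noncomputable def softTruncationDeriv (K z : ℝ) : ℝ := (K / (K + max z 0)) ^ 2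

/-! ### Elementary properties of the truncation -/

section softTruncation

variable {K : ℝ}

theorem softTruncation_of_nonneg {z : ℝ} (hz : 0 ≤ z) :
    softTruncation K z = K * z / (K + z) := by
  rcases hz.eq_or_lt with rfl | hz
  · simp [softTruncation]
  · rw [softTruncation, if_neg hz.not_ge]

theorem hasDerivAt_softTruncation (hK : 0 < K) (z : ℝ) :
    HasDerivAt (softTruncation K) (softTruncationDeriv K z) z := by
  have hpos : ∀ z : ℝ, 0 ≤ z → HasDerivAt (fun z : ℝ ↦ K * z / (K + z))
      (softTruncationDeriv K z) z := by
    intro z hz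
    have h1 : HasDerivAt (fun z : ℝ ↦ K * z) K z := by
      simpa using (hasDerivAt_id z).const_mul K
    have h2 : HasDerivAt (fun z : ℝ ↦ K + z) 1 z := (hasDerivAt_id z).const_add K
    have h3 : K + z ≠ 0 := by positivity
    refine (h1.fun_div h2 h3).congr_deriv ?_
    rw [softTruncationDeriv, max_eq_left hz]
    field_simp
    ring
  have hneg : ∀ z : ℝ, z ≤ 0 → softTruncationDeriv K z = 1 := by
    intro z hz
    rw [softTruncationDeriv, max_eq_right hz, add_zero, div_self hK.ne', one_pow]
  rcases lt_trichotomy z 0 with hz | rfl | hz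
  · rw [hneg z hz.le]
    refine (hasDerivAt_id z).congr_of_eventuallyEq ?_
    filter_upwards [Iio_mem_nhds hz] with x hx
    simp [softTruncation, (Set.mem_Iio.1 hx).le]
  · have h1 : HasDerivWithinAt (softTruncation K) (softTruncationDeriv K 0) (Set.Iic 0) 0 := by
      rw [hneg 0 le_rfl]
      refine (hasDerivWithinAt_id 0 _).congr (fun x hx ↦ ?_) (by simp [softTruncation])
      simp [softTruncation, Set.mem_Iic.1 hx]
    have h2 : HasDerivWithinAt (softTruncation K) (softTruncationDeriv K 0) (Set.Ici 0) 0 :=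
      (hpos 0 le_rfl).hasDerivWithinAt.congr (fun x hx ↦ softTruncation_of_nonneg hx)
        (softTruncation_of_nonneg le_rfl)
    have := h1.union h2
    rwa [Set.Iic_union_Ici, hasDerivWithinAt_univ] at this
  · refine (hpos z hz.le).congr_of_eventuallyEq ?_
    filter_upwards [Ioi_mem_nhds hz] with x hx
    exact softTruncation_of_nonneg (Set.mem_Ioi.1 hx).le

theorem softTruncationDeriv_nonneg (K z : ℝ) : 0 ≤ softTruncationDeriv K z := sq_nonneg _

theorem softTruncationDeriv_le_one (hK : 0 < K) (z : ℝ) : softTruncationDeriv K z ≤ 1 := by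
  have h := le_max_right z 0
  refine pow_le_one₀ (by positivity) ((div_le_one (by positivity)).2 (by linarith))

theorem continuous_softTruncationDeriv (hK : 0 < K) : Continuous (softTruncationDeriv K) := by
  unfold softTruncationDeriv
  refine (continuous_const.div (by fun_prop) fun z ↦ ?_).pow 2
  have h := le_max_right z 0
  positivity

theorem continuous_softTruncation (hK : 0 < K) : Continuous (softTruncation K) :=
  continuous_iff_continuousAt.2 fun z ↦ (hasDerivAt_softTruncation hK z).continuousAt

theorem monotone_softTruncation (hK : 0 < K) : Monotone (softTruncation K) :=
  monotone_of_deriv_nonneg (fun z ↦ (hasDerivAt_softTruncation hK z).differentiableAt) fun z ↦ by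
    rw [(hasDerivAt_softTruncation hK z).deriv]
    exact softTruncationDeriv_nonneg K z

theorem softTruncation_le (hK : 0 < K) (z : ℝ) : softTruncation K z ≤ K := by
  unfold softTruncation
  split_ifs with hz
  · linarith
  · push Not at hz
    rw [div_le_iff₀ (by positivity)]
    nlinarith

theorem softTruncation_le_self (hK : 0 < K) (z : ℝ) : softTruncation K z ≤ z := by
  unfold softTruncation
  split_ifs with hz
  · exact le_rfl
  · push Not at hz
    rw [div_le_iff₀ (by positivity)]
    nlinarith

theorem abs_softTruncation_le (hK : 0 < K) (z : ℝ) : |softTruncation K z| ≤ |z| := by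
  rcases le_total z 0 with hz | hz
  · simp [softTruncation, hz]
  · rw [abs_of_nonneg hz, abs_of_nonneg]
    · exact softTruncation_le_self hK z
    · rw [softTruncation_of_nonneg hz]
      positivity

/-- On $z\ge0$, with $r=K/(K+z)$, one has $\chi=rz$ and $\chi'=r^2$. For $a\ge0$ use $r^2\le r$ and
$r^2\le1$ termwise; for $a\le0$ use $r^2\le1$ on the nonnegative quantity $az+b$, then $\chi\le z$.
-/
theorem softTruncationDeriv_mul_le (hK : 0 < K) {a b z : ℝ} (hb : 0 < b) (hz : 0 ≤ a * z + b) :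
    softTruncationDeriv K z * (a * z + b) ≤ a * softTruncation K z + b := by
  rcases le_total z 0 with h0 | h0
  · simp [softTruncation, softTruncationDeriv, h0, hK.ne']
  have hr0 : 0 ≤ K / (K + z) := by positivity
  have hr1 : K / (K + z) ≤ 1 := (div_le_one (by positivity)).2 (by linarith)
  have e1 : softTruncationDeriv K z = (K / (K + z)) ^ 2 := by
    rw [softTruncationDeriv, max_eq_left h0]
  have e2 : softTruncation K z = K / (K + z) * z := by
    rw [softTruncation_of_nonneg h0]
    ring
  rw [e1, e2]
  generalize K / (K + z) = r at hr0 hr1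
  have hr2 : r ^ 2 ≤ 1 := pow_le_one₀ hr0 hr1
  rcases le_total 0 a with ha | ha
  · have h1 : r ^ 2 * (a * z) ≤ r * (a * z) := by
      have : r ^ 2 ≤ r := by nlinarith
      exact mul_le_mul_of_nonneg_right this (by positivity)
    nlinarith
  · have h1 : r ^ 2 * (a * z + b) ≤ a * z + b := mul_le_of_le_one_left hz hr2
    have h2 : a * z ≤ a * (r * z) :=
      mul_le_mul_of_nonpos_left (mul_le_of_le_one_left h0 hr1) ha
    linarith

theorem tendsto_softTruncation (t : ℝ) (ht : 0 ≤ t) :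
    Filter.Tendsto (fun K ↦ softTruncation K t) Filter.atTop (nhds t) := by
  have h1 : Filter.Tendsto (fun K : ℝ ↦ t - t ^ 2 / (K + t)) Filter.atTop (nhds (t - 0)) :=
    tendsto_const_nhds.sub ((Filter.tendsto_atTop_add_const_right _ t
      Filter.tendsto_id).const_div_atTop (t ^ 2))
  rw [sub_zero] at h1
  refine h1.congr' ?_
  filter_upwards [Filter.eventually_gt_atTop 0] with K hK
  have : K + t ≠ 0 := by positivity
  rw [softTruncation_of_nonneg ht]
  field_simp
  ring

end softTruncation

/-! ### Laplace transform of a variable bounded above -/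

section mgf

variable {Ω : Type*} [MeasurableSpace Ω] {P : Measure Ω} [IsProbabilityMeasure P] {U : Ω → ℝ}
  {K : ℝ}

theorem integrable_exp_mul_of_le (hU : AEStronglyMeasurable U P) (hK : ∀ ω, U ω ≤ K) {s : ℝ}
    (hs : 0 ≤ s) : Integrable (fun ω ↦ Real.exp (s * U ω)) P := by
  refine (integrable_const (Real.exp (s * K))).mono'
    (Real.continuous_exp.comp_aestronglyMeasurable (hU.const_mul s))
    (Filter.Eventually.of_forall fun ω ↦ ?_)
  rw [Real.norm_of_nonneg (Real.exp_pos _).le]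
  exact Real.exp_le_exp.2 (mul_le_mul_of_nonneg_left (hK ω) hs)

/-- For $0<x<s+1$ the upper bound on $U$ dominates $e^{xU}U$ by $e^{(s+1)K}|U|$. Negative $x$ must
be avoided, as $U$ need not be bounded below. -/
theorem hasDerivAt_integral_exp_mul (hU : Integrable U P) (hK0 : 0 ≤ K) (hK : ∀ ω, U ω ≤ K)
    {s : ℝ} (hs : 0 < s) :
    Integrable (fun ω ↦ Real.exp (s * U ω) * U ω) P ∧
      HasDerivAt (fun s ↦ ∫ ω, Real.exp (s * U ω) ∂P) (∫ ω, Real.exp (s * U ω) * U ω ∂P) s := by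
  refine hasDerivAt_integral_of_dominated_loc_of_deriv_le (μ := P)
    (F := fun s ω ↦ Real.exp (s * U ω)) (F' := fun s ω ↦ Real.exp (s * U ω) * U ω)
    (bound := fun ω ↦ Real.exp ((s + 1) * K) * ‖U ω‖)
    (Ioo_mem_nhds hs (lt_add_one s)) ?_ (integrable_exp_mul_of_le hU.1 hK hs.le) ?_ ?_
    (hU.norm.const_mul _) ?_
  · exact Filter.Eventually.of_forall fun x ↦
      Real.continuous_exp.comp_aestronglyMeasurable (hU.1.const_mul x)
  · exact (Real.continuous_exp.comp_aestronglyMeasurable (hU.1.const_mul s)).mul hU.1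
  · refine Filter.Eventually.of_forall fun ω x hx ↦ ?_
    rw [norm_mul, Real.norm_of_nonneg (Real.exp_pos _).le]
    refine mul_le_mul_of_nonneg_right (Real.exp_le_exp.2 ?_) (norm_nonneg _)
    exact (mul_le_mul_of_nonneg_left (hK ω) hx.1.le).trans
      (mul_le_mul_of_nonneg_right hx.2.le hK0)
  · refine Filter.Eventually.of_forall fun ω x _ ↦ ?_
    have h : HasDerivAt (fun x : ℝ ↦ x * U ω) (U ω) x := by
      simpa using (hasDerivAt_id x).mul_const (U ω)
    exact h.exp

/-- Supplies the endpoint $s=0$, which the differentiability lemma does not reach and where the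
initial value is read off. -/
theorem continuousOn_integral_exp_mul (hU : AEStronglyMeasurable U P) (hK0 : 0 ≤ K)
    (hK : ∀ ω, U ω ≤ K) (θ : ℝ) :
    ContinuousOn (fun s ↦ ∫ ω, Real.exp (s * U ω) ∂P) (Set.Icc 0 θ) := by
  refine continuousOn_of_dominated (bound := fun _ ↦ Real.exp (θ * K))
    (fun x _ ↦ Real.continuous_exp.comp_aestronglyMeasurable (hU.const_mul x))
    (fun x hx ↦ Filter.Eventually.of_forall fun ω ↦ ?_) (integrable_const _)
    (Filter.Eventually.of_forall fun ω ↦ by fun_prop)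
  rw [Real.norm_of_nonneg (Real.exp_pos _).le]
  exact Real.exp_le_exp.2 ((mul_le_mul_of_nonneg_left (hK ω) hx.1).trans
    (mul_le_mul_of_nonneg_right hx.2 hK0))

end mgf

/-- `W` satisfies the integration by parts formula `E[W φ(W)] = E[φ'(W) G] / 2` for all `C¹`
functions `φ` with bounded derivative. -/
def SatisfiesIBP {Ω : Type*} [MeasurableSpace Ω] (P : Measure Ω) (W G : Ω → ℝ) : Prop :=
  ∀ (φ ψ : ℝ → ℝ) (C : ℝ), (∀ x, HasDerivAt φ (ψ x) x) → Continuous ψ → (∀ x, ‖ψ x‖ ≤ C) →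
    ∫ ω, W ω * φ (W ω) ∂P = (∫ ω, ψ (W ω) * G ω ∂P) / 2

/-! ### From integration by parts to Chernoff bounds -/

namespace SatisfiesIBP

variable {Ω : Type*} [MeasurableSpace Ω] {P : Measure Ω} {W G : Ω → ℝ} {a b : ℝ}

/-- Since $G$ is unchanged, $G\le aW+b$ reads $G\le(-a)(-W)+b$; left tails thus become right tails
with $a$ negated. -/
theorem neg (h : SatisfiesIBP P W G) : SatisfiesIBP P (fun ω ↦ -W ω) G := by
  intro φ ψ C hφ hψc hψ
  have := h (fun x ↦ -φ (-x)) (fun x ↦ ψ (-x)) C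
    (fun x ↦ ((hφ (-x)).comp x (hasDerivAt_neg x)).fun_neg.congr_deriv (by ring))
    (hψc.comp continuous_neg) (fun x ↦ hψ _)
  rw [← this]
  congr 1
  funext ω
  ring

variable [IsProbabilityMeasure P]

/-- The differential inequality for the moment generating function of the truncated variable. -/
theorem deriv_mgf_le (h : SatisfiesIBP P W G) (hW : Integrable W P) (hb : 0 < b)
    (hG0 : ∀ᵐ ω ∂P, 0 ≤ G ω) (hG : ∀ᵐ ω ∂P, G ω ≤ a * W ω + b) {K : ℝ} (hK : 0 < K) {s : ℝ}
    (hs : 0 < s) :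
    ∫ ω, Real.exp (s * softTruncation K (W ω)) * softTruncation K (W ω) ∂P ≤
      s / 2 * (a * ∫ ω, Real.exp (s * softTruncation K (W ω)) * softTruncation K (W ω) ∂P +
        b * ∫ ω, Real.exp (s * softTruncation K (W ω)) ∂P) := by
  set χ := softTruncation K with hχ
  have hUm : AEStronglyMeasurable (fun ω ↦ χ (W ω)) P :=
    (continuous_softTruncation hK).comp_aestronglyMeasurable hW.1
  have hU : Integrable (fun ω ↦ χ (W ω)) P :=
    hW.norm.mono' hUm (Filter.Eventually.of_forall fun ω ↦ abs_softTruncation_le hK _)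
  have iE := integrable_exp_mul_of_le hUm (fun ω ↦ softTruncation_le hK (W ω)) hs.le
  have iEU := (hasDerivAt_integral_exp_mul hU hK.le (fun ω ↦ softTruncation_le hK (W ω)) hs).1
  have hbd : ∀ z, Real.exp (s * χ z) ≤ Real.exp (s * K) := fun z ↦
    Real.exp_le_exp.2 (mul_le_mul_of_nonneg_left (softTruncation_le hK z) hs.le)
  have iEb : ∀ {w : Ω → ℝ}, Integrable w P →
      Integrable (fun ω ↦ Real.exp (s * χ (W ω)) * w ω) P := fun hw ↦
    hw.bdd_mul iE.1 (c := Real.exp (s * K)) (Filter.Eventually.of_forall fun ω ↦ by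
      rw [Real.norm_of_nonneg (Real.exp_pos _).le]
      exact hbd _)
  have hder : ∀ z, HasDerivAt (fun z ↦ Real.exp (s * χ z))
      (Real.exp (s * χ z) * (s * softTruncationDeriv K z)) z := fun z ↦
    ((hasDerivAt_softTruncation hK z).const_mul s).exp
  have hcont : Continuous fun z ↦ Real.exp (s * χ z) * (s * softTruncationDeriv K z) :=
    (Real.continuous_exp.comp (continuous_const.mul (continuous_softTruncation hK))).mul
      (continuous_const.mul (continuous_softTruncationDeriv hK))
  have ibp := h _ _ (Real.exp (s * K) * s) hder hcont fun z ↦ by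
    rw [Real.norm_of_nonneg (mul_nonneg (Real.exp_pos _).le
      (mul_nonneg hs.le (softTruncationDeriv_nonneg K z)))]
    exact mul_le_mul (hbd z) (mul_le_of_le_one_right hs.le (softTruncationDeriv_le_one hK z))
      (mul_nonneg hs.le (softTruncationDeriv_nonneg K z)) (Real.exp_pos _).le
  calc ∫ ω, Real.exp (s * χ (W ω)) * χ (W ω) ∂P ≤ ∫ ω, W ω * Real.exp (s * χ (W ω)) ∂P := by
        refine integral_mono iEU (by simpa only [mul_comm] using iEb hW) fun ω ↦ ?_
        rw [mul_comm]
        exact mul_le_mul_of_nonneg_right (softTruncation_le_self hK _) (Real.exp_pos _).le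
    _ = (∫ ω, Real.exp (s * χ (W ω)) * (s * softTruncationDeriv K (W ω)) * G ω ∂P) / 2 := ibp
    _ ≤ (∫ ω, s * (a * (Real.exp (s * χ (W ω)) * χ (W ω)) + b * Real.exp (s * χ (W ω))) ∂P) /
        2 := by
        refine div_le_div_of_nonneg_right (integral_mono_of_nonneg ?_ ?_ ?_) zero_le_two
        · filter_upwards [hG0] with ω h0
          exact mul_nonneg (mul_nonneg (Real.exp_pos _).le
            (mul_nonneg hs.le (softTruncationDeriv_nonneg K _))) h0
        · exact ((iEU.const_mul a).add (iE.const_mul b)).const_mul s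
        · filter_upwards [hG0, hG] with ω h0 h1
          -- Nonnegativity of $G$ enters here: it forces $aW+b\ge0$, as the truncation inequality
          -- requires.
          have h2 : softTruncationDeriv K (W ω) * G ω ≤ a * χ (W ω) + b :=
            (mul_le_mul_of_nonneg_left h1 (softTruncationDeriv_nonneg K _)).trans
              (softTruncationDeriv_mul_le hK hb (h0.trans h1))
          have h3 := mul_le_mul_of_nonneg_left h2
            (mul_nonneg hs.le (Real.exp_pos (s * χ (W ω))).le)
          refine le_trans (le_of_eq ?_) (h3.trans (le_of_eq ?_)) <;> ring
    _ = _ := by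
        rw [integral_const_mul, integral_add (iEU.const_mul a) (iE.const_mul b),
          integral_const_mul, integral_const_mul]
        ring

/-- A Grönwall argument: $M'\le MA'$ makes $Me^{-A}$ nonincreasing, and it equals $1$ at $0$. The
resulting bound does not depend on $K$. Leaving the antiderivative $A$ free covers $a=0$ and $a\ne0$
together. -/
theorem mgf_le (h : SatisfiesIBP P W G) (hW : Integrable W P) (hb : 0 < b)
    (hG0 : ∀ᵐ ω ∂P, 0 ≤ G ω) (hG : ∀ᵐ ω ∂P, G ω ≤ a * W ω + b) {K : ℝ} (hK : 0 < K) {θ : ℝ}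
    (hθ : 0 < θ) (hθa : 0 < 1 - a * θ / 2) {A : ℝ → ℝ} (hA0 : A 0 = 0)
    (hA : ∀ s ∈ Set.Icc 0 θ, HasDerivAt A (b * s / 2 / (1 - a * s / 2)) s) :
    ∫ ω, Real.exp (θ * softTruncation K (W ω)) ∂P ≤ Real.exp (A θ) := by
  have hUm : AEStronglyMeasurable (fun ω ↦ softTruncation K (W ω)) P :=
    (continuous_softTruncation hK).comp_aestronglyMeasurable hW.1
  have hU : Integrable (fun ω ↦ softTruncation K (W ω)) P :=
    hW.norm.mono' hUm (Filter.Eventually.of_forall fun ω ↦ abs_softTruncation_le hK _)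
  set M : ℝ → ℝ := fun s ↦ ∫ ω, Real.exp (s * softTruncation K (W ω)) ∂P with hM
  have hMd := fun {s : ℝ} (hs : 0 < s) ↦
    (hasDerivAt_integral_exp_mul hU hK.le (fun ω ↦ softTruncation_le hK (W ω)) hs).2
  have hLd : ∀ s ∈ Set.Ioo 0 θ, HasDerivAt (fun s ↦ M s * Real.exp (-A s))
      ((∫ ω, Real.exp (s * softTruncation K (W ω)) * softTruncation K (W ω) ∂P) *
        Real.exp (-A s) + M s * (Real.exp (-A s) * -(b * s / 2 / (1 - a * s / 2)))) s :=
    fun s hs ↦ (hMd hs.1).fun_mul (hA s ⟨hs.1.le, hs.2.le⟩).fun_neg.exp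
  have hanti : AntitoneOn (fun s ↦ M s * Real.exp (-A s)) (Set.Icc 0 θ) := by
    refine antitoneOn_of_deriv_nonpos (convex_Icc 0 θ) ?_ ?_ ?_
    · refine (continuousOn_integral_exp_mul hUm hK.le (fun ω ↦ softTruncation_le hK (W ω))
        θ).mul (Real.continuous_exp.comp_continuousOn (ContinuousOn.neg fun s hs ↦ ?_))
      exact (hA s hs).continuousAt.continuousWithinAt
    · rw [interior_Icc]
      exact fun s hs ↦ (hLd s hs).differentiableAt.differentiableWithinAt
    · rw [interior_Icc]
      intro s hs
      rw [(hLd s hs).deriv]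
      have hsa : 0 < 1 - a * s / 2 := by
        rcases le_total 0 a with ha | ha
        · have := mul_le_mul_of_nonneg_left hs.2.le ha
          linarith
        · have := mul_nonpos_of_nonpos_of_nonneg ha hs.1.le
          linarith
      have key := h.deriv_mgf_le hW hb hG0 hG hK hs.1
      set M' := ∫ ω, Real.exp (s * softTruncation K (W ω)) * softTruncation K (W ω) ∂P
      have h1 : M' ≤ M s * (b * s / 2 / (1 - a * s / 2)) := by
        rw [mul_div_assoc', le_div_iff₀ hsa]
        linarith
      have h2 := mul_le_mul_of_nonneg_right h1 (Real.exp_pos (-A s)).le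
      linarith
  have h1 := hanti (Set.left_mem_Icc.2 hθ.le) (Set.right_mem_Icc.2 hθ.le) hθ.le
  simp only [hA0, hM, zero_mul, Real.exp_zero, neg_zero, mul_one, integral_const, probReal_univ,
    smul_eq_mul, Real.exp_neg] at h1
  rwa [← div_eq_mul_inv, div_le_one (Real.exp_pos _)] at h1

/-- Chernoff's bound for $\chi_K(W)$, where monotonicity of $\chi_K$ transports the event; then
$\chi_K(t)\to t$. -/
theorem measureReal_le (h : SatisfiesIBP P W G) (hW : Integrable W P) (hb : 0 < b)
    (hG0 : ∀ᵐ ω ∂P, 0 ≤ G ω) (hG : ∀ᵐ ω ∂P, G ω ≤ a * W ω + b) {t θ : ℝ} (ht : 0 < t)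
    (hθ : 0 < θ) (hθa : 0 < 1 - a * θ / 2) {A : ℝ → ℝ} (hA0 : A 0 = 0)
    (hA : ∀ s ∈ Set.Icc 0 θ, HasDerivAt A (b * s / 2 / (1 - a * s / 2)) s) :
    P.real {ω | t ≤ W ω} ≤ Real.exp (-θ * t + A θ) := by
  have hlim : Filter.Tendsto (fun K ↦ Real.exp (-θ * softTruncation K t + A θ)) Filter.atTop
      (nhds (Real.exp (-θ * t + A θ))) :=
    (Real.continuous_exp.tendsto _).comp
      (((tendsto_softTruncation t ht.le).const_mul (-θ)).add_const (A θ))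
  refine ge_of_tendsto hlim ?_
  filter_upwards [Filter.eventually_gt_atTop 0] with K hK
  have hUm : AEStronglyMeasurable (fun ω ↦ softTruncation K (W ω)) P :=
    (continuous_softTruncation hK).comp_aestronglyMeasurable hW.1
  calc P.real {ω | t ≤ W ω} ≤ P.real {ω | softTruncation K t ≤ softTruncation K (W ω)} :=
        measureReal_mono fun ω hω ↦ monotone_softTruncation hK hω
    _ ≤ Real.exp (-θ * softTruncation K t) * mgf (fun ω ↦ softTruncation K (W ω)) P θ :=
        measure_ge_le_exp_mul_mgf _ hθ.le
          (integrable_exp_mul_of_le hUm (fun ω ↦ softTruncation_le hK (W ω)) hθ.le)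
    _ ≤ Real.exp (-θ * softTruncation K t) * Real.exp (A θ) :=
        mul_le_mul_of_nonneg_left (h.mgf_le hW hb hG0 hG hK hθ hθa hA0 hA) (Real.exp_pos _).le
    _ = _ := (Real.exp_add _ _).symm

theorem measureReal_le_of_eq_zero (h : SatisfiesIBP P W G) (hW : Integrable W P) (hb : 0 < b)
    (hG0 : ∀ᵐ ω ∂P, 0 ≤ G ω) (hG : ∀ᵐ ω ∂P, G ω ≤ b) {t : ℝ} (ht : 0 < t) :
    P.real {ω | t ≤ W ω} ≤ Real.exp (-(t ^ 2 / b)) := by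
  -- This $\theta$ minimises $-\theta t+b\theta^2/4$.
  refine (h.measureReal_le (a := 0) (θ := 2 * t / b) (A := fun s ↦ b * s ^ 2 / 4) hW hb hG0
    (by simpa using hG) ht (by positivity) (by norm_num) (by simp) fun s _ ↦ ?_).trans
    (le_of_eq ?_)
  · refine (((hasDerivAt_pow 2 s).const_mul b).div_const 4).congr_deriv ?_
    push_cast
    ring
  · congr 1
    field_simp
    ring

/-- The sign of $a$ is left free so that both tails are covered; for $a<0$ the condition $at+b>0$
says $t<b/|a|$. -/
theorem measureReal_le_of_ne_zero (h : SatisfiesIBP P W G) (hW : Integrable W P) (hb : 0 < b)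
    (hG0 : ∀ᵐ ω ∂P, 0 ≤ G ω) (hG : ∀ᵐ ω ∂P, G ω ≤ a * W ω + b) (ha : a ≠ 0) {t : ℝ} (ht : 0 < t)
    (hat : 0 < a * t + b) :
    P.real {ω | t ≤ W ω} ≤
      Real.exp (-(2 * t / a)) * (1 + a * t / b) ^ (2 * b / a ^ 2) := by
  have e1 : 1 - a * (2 * t / (a * t + b)) / 2 = b / (a * t + b) := by
    field_simp
    ring
  have hθa : 0 < 1 - a * (2 * t / (a * t + b)) / 2 := by
    rw [e1]
    positivity
  have hpos : 0 < 1 + a * t / b := by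
    have : 1 + a * t / b = (a * t + b) / b := by field_simp; ring
    rw [this]
    positivity
  -- The choice of $\theta$ solves $A'(\theta)=t$, the stationarity condition for $-\theta
  -- t+A(\theta)$.
  refine (h.measureReal_le (a := a) (θ := 2 * t / (a * t + b))
    (A := fun s ↦ b / a * (-s - 2 / a * Real.log (1 - a * s / 2))) hW hb hG0 hG ht
    (by positivity) hθa (by simp) fun s hs ↦ ?_).trans (le_of_eq ?_)
  · have hsa : 0 < 1 - a * s / 2 := by
      rcases le_total 0 a with ha | ha
      · have := mul_le_mul_of_nonneg_left hs.2 ha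
        linarith
      · have := mul_nonpos_of_nonpos_of_nonneg ha hs.1
        linarith
    have h1 : HasDerivAt (fun s : ℝ ↦ 1 - a * s / 2) (-(a / 2)) s := by
      simpa using (((hasDerivAt_id s).const_mul a).div_const 2).const_sub 1
    have h2 := (((hasDerivAt_id s).neg.sub ((h1.log hsa.ne').const_mul (2 / a))).const_mul (b / a))
    refine h2.congr_deriv ?_
    have : 2 - a * s ≠ 0 := by linarith
    have h3 : 1 - a * s / 2 = (2 - a * s) / 2 := by ring
    rw [h3]
    field_simp
    ring
  · rw [Real.rpow_def_of_pos hpos, ← Real.exp_add, e1]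
    have e2 : 1 + a * t / b = (b / (a * t + b))⁻¹ := by field_simp; ring
    rw [e2, Real.log_inv]
    congr 1
    have e3 : 2 * t / (a * t + b) * (t + b / a) = 2 * t / a := by
      rw [show t + b / a = (a * t + b) / a by field_simp]
      have hne := hat.ne'
      generalize a * t + b = d at hne
      field_simp
    linear_combination -e3

end SatisfiesIBP

/-! ### Comparison of the tail bounds -/

/-- With $u=1+at/b>1$, the claim is $\log u<\frac12(u-u^{-1})$, which is $x<\sinh x$ at $x=\log u$.
-/
theorem rightTailBound_lt {a b t : ℝ} (ha : 0 < a) (hb : 0 < b) (ht : 0 < t) :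
    rightTailBound a b t < Real.exp (-(t ^ 2 / (a * t + b))) := by
  have hpos : 1 < 1 + a * t / b := by
    have : 0 < a * t / b := by positivity
    linarith
  have hlog : Real.log (1 + a * t / b) < ((1 + a * t / b) - (1 + a * t / b)⁻¹) / 2 := by
    rw [← Real.sinh_log (by linarith)]
    exact Real.self_lt_sinh_iff.2 (Real.log_pos hpos)
  rw [rightTailBound, if_neg ha.ne', Real.rpow_def_of_pos (by linarith), ← Real.exp_add,
    Real.exp_lt_exp]
  have h1 := mul_lt_mul_of_pos_right hlog (show 0 < 2 * b / a ^ 2 by positivity)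
  have h2 : -(2 * t / a) + ((1 + a * t / b) - (1 + a * t / b)⁻¹) / 2 * (2 * b / a ^ 2) =
      -(t ^ 2 / (a * t + b)) := by
    have e : (1 + a * t / b)⁻¹ = b / (a * t + b) := by field_simp; ring
    have hne : a * t + b ≠ 0 := by positivity
    rw [e]
    field_simp
    ring
  linarith

theorem log_one_sub_lt {u : ℝ} (h0 : 0 < u) (h1 : u < 1) : Real.log (1 - u) < -u - u ^ 2 / 2 := by
  have h := Real.hasSum_pow_div_log_of_abs_lt_one (x := u) (by rwa [abs_of_pos h0])
  -- Two terms of the series for $-\log(1-u)$ give the bound; the third makes it strict.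
  have h2 := sum_le_hasSum (Finset.range 3) (fun i _ ↦ by positivity) h
  simp only [Finset.sum_range_succ, Finset.sum_range_zero] at h2
  norm_num at h2
  have h3 : 0 < u ^ 3 / 3 := by positivity
  linarith

theorem leftTailBound_of_le {a b t : ℝ} (ha : 0 < a) (hb : 0 < b) (ht : b / a ≤ t) :
    leftTailBound a b t = 0 := by
  rw [leftTailBound, if_neg ha.ne']
  rcases ht.eq_or_lt with rfl | h
  · rw [Set.indicator_of_mem (Set.right_mem_Icc.2 (by positivity))]
    have : 1 - a * (b / a) / b = 0 := by field_simp; ring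
    rw [this, Real.zero_rpow (by positivity), mul_zero]
  · exact Set.indicator_of_notMem (fun hm ↦ hm.2.not_gt h) _

theorem leftTailBound_of_lt {a b t : ℝ} (ha : 0 < a) (ht : 0 < t) (htb : t < b / a) :
    leftTailBound a b t = Real.exp (2 * t / a) * (1 - a * t / b) ^ (2 * b / a ^ 2) := by
  rw [leftTailBound, if_neg ha.ne', Set.indicator_of_mem (Set.mem_Icc.2 ⟨ht.le, htb.le⟩)]

theorem leftTailBound_lt {a b t : ℝ} (ha : 0 < a) (hb : 0 < b) (ht : 0 < t) :
    leftTailBound a b t < Real.exp (-(t ^ 2 / b)) := by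
  rcases lt_or_ge t (b / a) with h | h
  · rw [leftTailBound_of_lt ha ht h]
    have hu1 : a * t / b < 1 := by
      rw [div_lt_one hb, mul_comm]
      exact (lt_div_iff₀ ha).1 h
    have hlog := log_one_sub_lt (show 0 < a * t / b by positivity) hu1
    rw [Real.rpow_def_of_pos (by linarith), ← Real.exp_add, Real.exp_lt_exp]
    have h1 := mul_lt_mul_of_pos_right hlog (show 0 < 2 * b / a ^ 2 by positivity)
    have h2 : 2 * t / a + (-(a * t / b) - (a * t / b) ^ 2 / 2) * (2 * b / a ^ 2) =
        -(t ^ 2 / b) := by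
      field_simp
      ring
    linarith
  · rw [leftTailBound_of_le ha hb h]
    exact Real.exp_pos _

/-! ### The tail bounds -/

namespace SatisfiesIBP

variable {Ω : Type*} [MeasurableSpace Ω] {P : Measure Ω} [IsProbabilityMeasure P] {W G : Ω → ℝ}
  {a b : ℝ}

theorem measureReal_le_rightTailBound (h : SatisfiesIBP P W G) (hW : Integrable W P)
    (ha : 0 ≤ a) (hb : 0 < b) (hG0 : ∀ᵐ ω ∂P, 0 ≤ G ω) (hG : ∀ᵐ ω ∂P, G ω ≤ a * W ω + b)
    {t : ℝ} (ht : 0 < t) : P.real {ω | t ≤ W ω} ≤ rightTailBound a b t := by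
  rcases ha.eq_or_lt with rfl | ha
  · rw [rightTailBound, if_pos rfl]
    exact h.measureReal_le_of_eq_zero hW hb hG0 (by simpa using hG) ht
  · rw [rightTailBound, if_neg ha.ne']
    exact h.measureReal_le_of_ne_zero hW hb hG0 hG ha.ne' ht (by positivity)

theorem measureReal_le_leftTailBound (h : SatisfiesIBP P W G) (hW : Integrable W P)
    (ha : 0 ≤ a) (hb : 0 < b) (hG0 : ∀ᵐ ω ∂P, 0 ≤ G ω) (hG : ∀ᵐ ω ∂P, G ω ≤ a * W ω + b)
    {t : ℝ} (ht : 0 < t) : P.real {ω | W ω ≤ -t} ≤ leftTailBound a b t := by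
  have hset : ∀ t, {ω | W ω ≤ -t} = {ω | t ≤ -W ω} := fun t ↦ by
    ext ω
    exact le_neg (a := W ω) (b := t)
  rcases ha.eq_or_lt with rfl | ha
  · rw [leftTailBound, if_pos rfl, hset]
    exact h.neg.measureReal_le_of_eq_zero hW.neg hb hG0 (by simpa using hG) ht
  have hlt : ∀ s, 0 < s → s < b / a → P.real {ω | W ω ≤ -s} ≤
      Real.exp (2 * s / a) * (1 - a * s / b) ^ (2 * b / a ^ 2) := by
    intro s hs hsb
    rw [hset]
    refine (h.neg.measureReal_le_of_ne_zero (a := -a) hW.neg hb hG0 ?_ (neg_ne_zero.2 ha.ne') hs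
      ?_).trans (le_of_eq ?_)
    · filter_upwards [hG] with ω hω
      linarith
    · have := (lt_div_iff₀ ha).1 hsb
      linarith
    · congr 2
      · rw [div_neg, neg_neg]
      · ring
      · ring
  rcases lt_or_ge t (b / a) with htb | htb
  · rw [leftTailBound_of_lt ha ht htb]
    exact hlt t ht htb
  · rw [leftTailBound_of_le ha hb htb]
    -- For $t\ge b/a$, compare with $s\uparrow b/a$: the event is contained in $\{W\le -s\}$, whose
    -- bound tends to $0$.
    have hba : 0 < b / a := by positivity
    have hcont : ContinuousAt
        (fun s ↦ Real.exp (2 * s / a) * (1 - a * s / b) ^ (2 * b / a ^ 2)) (b / a) := by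
      refine ContinuousAt.mul (by fun_prop) (ContinuousAt.rpow_const (by fun_prop) (Or.inr ?_))
      positivity
    have hlim := hcont.tendsto.mono_left (nhdsWithin_le_nhds (s := Set.Iio (b / a)))
    have e : 1 - a * (b / a) / b = 0 := by field_simp; ring
    rw [e, Real.zero_rpow (by positivity), mul_zero] at hlim
    refine ge_of_tendsto hlim ?_
    filter_upwards [Ioo_mem_nhdsLT hba] with s hs
    refine (measureReal_mono fun ω hω ↦ ?_).trans (hlt s hs.1 hs.2)
    have hω' : W ω ≤ -t := hω
    exact hω'.trans (neg_le_neg (hs.2.le.trans htb))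

end SatisfiesIBP

theorem proposition3 {Ω H : Type*} [MeasurableSpace Ω] (P : Measure Ω) [IsProbabilityMeasure P]
    [NormedAddCommGroup H] [InnerProductSpace ℝ H] [CompleteSpace H]
    [TopologicalSpace.SeparableSpace H]
    (X : H → Ω → ℝ) (hX : IsIsonormal X P)
    (f : symmetricTensorSquare H) (Z : Lp ℝ 2 P) (hZ : Z = hX.doubleIntegral f)
    (DZ : Lp H 2 P) (hDZ : IsMalliavinDerivative X P Z DZ)
    (a b : ℝ) (ha : 0 ≤ a) (hb : 0 < b)
    (hZab : ∀ᵐ ω ∂P, ‖DZ ω‖ ^ 2 ≤ a * Z ω + b) :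
    ∀ t : ℝ, 0 < t →
      P.real {ω | t ≤ Z ω} ≤ rightTailBound a b t ∧
      P.real {ω | Z ω ≤ -t} ≤ leftTailBound a b t ∧
      rightTailBound a b t ≤ Real.exp (-(t ^ 2 / (a * t + b))) ∧
      leftTailBound a b t ≤ Real.exp (-(t ^ 2 / b)) ∧
      (0 < a → rightTailBound a b t < Real.exp (-(t ^ 2 / (a * t + b))) ∧
        leftTailBound a b t < Real.exp (-(t ^ 2 / b))) := by
  intro t ht
  have hibp : SatisfiesIBP P Z fun ω ↦ ‖DZ ω‖ ^ 2 := by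
    subst hZ
    exact fun φ ψ C hφ hψc hψ ↦ hX.integral_doubleIntegral_mul f hDZ hφ hψc hψ
  have hint : Integrable Z P := (Lp.memLp Z).integrable (by norm_num)
  have hG0 : ∀ᵐ ω ∂P, 0 ≤ ‖DZ ω‖ ^ 2 := Filter.Eventually.of_forall fun ω ↦ sq_nonneg _
  refine ⟨hibp.measureReal_le_rightTailBound hint ha hb hG0 hZab ht,
    hibp.measureReal_le_leftTailBound hint ha hb hG0 hZab ht, ?_, ?_,
    fun ha ↦ ⟨rightTailBound_lt ha hb ht, leftTailBound_lt ha hb ht⟩⟩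
  · rcases ha.eq_or_lt with rfl | ha
    · simp [rightTailBound]
    · exact (rightTailBound_lt ha hb ht).le
  · rcases ha.eq_or_lt with rfl | ha
    · simp [leftTailBound]
    · exact (leftTailBound_lt ha hb ht).le
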